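/- Let $n,l$ be positive integers with $4l\ge n+1$, and let all $L^2$-spaces be complex. In $L^2(\mathbb R^n)$ let $A$ be the operator of multiplication by $|k|^{2l}$ with domain $D(A)=\{f\in L^2(\mathbb R^n): |k|^{2l}f\in L^2(\mathbb R^n)\}$, and let $A_0$ be the restriction of $A$ to $\{f\in D(A): f\in L^1(\mathbb R^n),\ \int_{\mathbb R^n} f(k)\,dk=0\}$. (For $4l\ge n+1$ every $f\in D(A)$ is integrable.) A *non-negative extension* of $A_0$ is a non-negative self-adjoint operator $B$ in $L^2(\mathbb R^n)$ with $A_0\subseteq B$; a *non-negative singular perturbation* of $A$ associated with $A_0$ is a non-negative extension $B$ of $A_0$ with $B\ne A$. Non-negative self-adjoint operators are ordered by $$B_1\le B_2\iff (I+B_2)^{-1}\le (I+B_1)^{-1}.$$ Then $A$ is itself a non-negative extension of $A_0$, and: 1. if $n<2l$, there are infinitely many non-negative singular perturbations of $A$ associated with $A_0$, and $A$ is the minimal element of the set of non-negative extensions of $A_0$, that is, $A\le B$ for every such extension $B$; 2. if $n=2l$, there are no non-negative singular perturbations of $A$ associated with $A_0$; 3. if $n>2l$, there are infinitely many non-negative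 singular perturbations of $A$ associated with $A_0$, and $A$ is the maximal element of the set of non-negative extensions of $A_0$, that is, $B\le A$ for every such extension $B$. The same assertions hold, in the position representation, with $A$ replaced by the polyharmonic operator $(-\Delta)^l$ in $L^2(\mathbb R^n)$, with domain $\{f\in L^2(\mathbb R^n): (-\Delta)^l f\in L^2(\mathbb R^n)\text{ in the sense of distributions}\}$, and $A_0$ replaced by its restriction to those $f$ in this domain whose continuous representative satisfies $f(0)=0$. -/

import Mathlib

open MeasureTheory
open scoped SchwartzMap Laplacian

noncomputable section

namespace PointPerturbation

section Abstract

variable {H : Type*} [NormedAddCommGroup H] [InnerProductSpace ℂ H] [CompleteSpace H]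

/-- A (possibly unbounded) operator `A` is non-negative if `⟪A x, x⟫ ≥ 0` on its domain. It is only
used for self-adjoint `A`, for which `⟪A x, x⟫` is automatically real. -/
def IsNonneg (A : H →ₗ.[ℂ] H) : Prop :=
  ∀ x : A.domain, 0 ≤ (inner ℂ (A x) (x : H)).re

/-- The set of all non-negative self-adjoint extensions, in the same Hilbert space, of `A₀`.
Here `A₀ ≤ B` is inclusion of graphs. -/
def nonnegExtensions (A₀ : H →ₗ.[ℂ] H) : Set (H →ₗ.[ℂ] H) :=
  {B | IsSelfAdjoint B ∧ IsNonneg B ∧ A₀ ≤ B}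

/-- The non-negative singular perturbations of `A` associated with its restriction `A₀`: the
non-negative self-adjoint extensions of `A₀` other than `A`. -/
def nonnegSingularPerturbations (A A₀ : H →ₗ.[ℂ] H) : Set (H →ₗ.[ℂ] H) :=
  {B | B ∈ nonnegExtensions A₀ ∧ B ≠ A}

/-- The bounded operator `R` is the inverse `(I + A)⁻¹` of `I + A : D(A) → H`. -/
def IsInverseOneAdd (A : H →ₗ.[ℂ] H) (R : H →L[ℂ] H) : Prop :=
  (∀ x : A.domain, R ((x : H) + A x) = x) ∧
    ∀ h : H, ∃ x : A.domain, (x : H) = R h ∧ (x : H) + A x = h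

/-- The order on non-negative self-adjoint operators: `A` is below `B` if
`(I + B)⁻¹ ≤ (I + A)⁻¹` as bounded operators (Loewner order). -/
def OpLE (A B : H →ₗ.[ℂ] H) : Prop :=
  ∃ R S : H →L[ℂ] H, IsInverseOneAdd A R ∧ IsInverseOneAdd B S ∧ S ≤ R

/-- `A` is the minimal element of a set of operators. -/
def IsMinimalElement (𝒢 : Set (H →ₗ.[ℂ] H)) (A : H →ₗ.[ℂ] H) : Prop :=
  A ∈ 𝒢 ∧ ∀ B ∈ 𝒢, OpLE A B

/-- `A` is the maximal element of a set of operators. -/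
def IsMaximalElement (𝒢 : Set (H →ₗ.[ℂ] H)) (A : H →ₗ.[ℂ] H) : Prop :=
  A ∈ 𝒢 ∧ ∀ B ∈ 𝒢, OpLE B A

end Abstract

/-- The Hilbert space `L²(ℝⁿ)`. -/
abbrev L2 (n : ℕ) : Type := Lp ℂ 2 (volume : Measure (EuclideanSpace ℝ (Fin n)))

section Momentum

/-- The natural domain `{f ∈ L² : |k|^{2l} f ∈ L²}` of multiplication by `|k|^{2l}`. -/
def mulPowDomain (n l : ℕ) : Submodule ℂ (L2 n) where
  carrier := {f | MemLp (fun k ↦ ((‖k‖ ^ (2 * l) : ℝ) : ℂ) * f k) 2 volume}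
  zero_mem' := by
    refine MemLp.ae_eq ?_ (MemLp.zero' (ε := ℂ))
    filter_upwards [Lp.coeFn_zero ℂ 2 (volume : Measure (EuclideanSpace ℝ (Fin n)))] with k hk
    rw [hk, Pi.zero_apply, mul_zero]
  add_mem' := fun {f g} hf hg ↦ by
    refine (MemLp.add hf hg).ae_eq ?_
    filter_upwards [Lp.coeFn_add f g] with k hk
    rw [hk, Pi.add_apply, Pi.add_apply, mul_add]
  smul_mem' := fun c f hf ↦ by
    refine (MemLp.const_mul hf c).ae_eq ?_
    filter_upwards [Lp.coeFn_smul c f] with k hk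
    rw [hk, Pi.smul_apply, smul_eq_mul, mul_left_comm]

theorem memLp_of_mem_mulPowDomain {n l : ℕ} {f : L2 n} (hf : f ∈ mulPowDomain n l) :
    MemLp (fun k ↦ ((‖k‖ ^ (2 * l) : ℝ) : ℂ) * f k) 2 volume := hf

/-- The operator of multiplication by `|k|^{2l}` in `L²(ℝⁿ)`, on its natural domain. -/
def mulPow (n l : ℕ) : L2 n →ₗ.[ℂ] L2 n where
  domain := mulPowDomain n l
  toFun :=
    { toFun := fun f ↦ MemLp.toLp (fun k ↦ ((‖k‖ ^ (2 * l) : ℝ) : ℂ) * (f : L2 n) k)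
        (memLp_of_mem_mulPowDomain f.2)
      map_add' := fun f g ↦ by
        rw [← MemLp.toLp_add]
        refine MemLp.toLp_congr _ _ ?_
        filter_upwards [Lp.coeFn_add (f : L2 n) (g : L2 n)] with k hk
        rw [Submodule.coe_add, hk, Pi.add_apply, Pi.add_apply, mul_add]
      map_smul' := fun c f ↦ by
        rw [RingHom.id_apply, ← MemLp.toLp_const_smul]
        refine MemLp.toLp_congr _ _ ?_
        filter_upwards [Lp.coeFn_smul c (f : L2 n)] with k hk
        rw [Submodule.coe_smul, hk, Pi.smul_apply, Pi.smul_apply, smul_eq_mul, smul_eq_mul,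
          mul_left_comm] }

/-- The functions `f ∈ L²(ℝⁿ)` that are integrable with `∫ f(k) dk = 0`. -/
def integralZero (n : ℕ) : Submodule ℂ (L2 n) where
  carrier := {f | Integrable f volume ∧ ∫ k, f k = 0}
  zero_mem' := by
    have h := Lp.coeFn_zero ℂ 2 (volume : Measure (EuclideanSpace ℝ (Fin n)))
    exact ⟨(integrable_zero _ _ _).congr h.symm, by rw [integral_congr_ae h]; simp⟩
  add_mem' := fun {f g} hf hg ↦ by
    have h := Lp.coeFn_add f g
    refine ⟨(hf.1.add hg.1).congr h.symm, ?_⟩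
    rw [integral_congr_ae h, integral_add' hf.1 hg.1, hf.2, hg.2, add_zero]
  smul_mem' := fun c f hf ↦ by
    have h := Lp.coeFn_smul c f
    refine ⟨(hf.1.smul c).congr h.symm, ?_⟩
    rw [integral_congr_ae h]
    simp only [Pi.smul_apply]
    rw [integral_smul, hf.2, smul_zero]

/-- The one-point restriction of `mulPow n l`, with domain
`{f : f ∈ D(|k|^{2l}), ∫ f(k) dk = 0}`. -/
def mulPowPoint (n l : ℕ) : L2 n →ₗ.[ℂ] L2 n :=
  (mulPow n l).domRestrict (integralZero n)

end Momentum

section Position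

/-- The embedding of `L²(ℝⁿ)` into the tempered distributions. -/
def toDistr (n : ℕ) : L2 n →ₗ[ℂ] 𝓢'(EuclideanSpace ℝ (Fin n), ℂ) :=
  (Lp.toTemperedDistributionCLM ℂ (volume : Measure (EuclideanSpace ℝ (Fin n))) 2).toLinearMap

theorem toDistr_injective (n : ℕ) : Function.Injective (toDistr n) :=
  LinearMap.ker_eq_bot.mp Lp.ker_toTemperedDistributionCLM_eq_bot

/-- The distributional Laplacian `Δ`, as a linear map. -/
def distrLaplacian (n : ℕ) : Module.End ℂ 𝓢'(EuclideanSpace ℝ (Fin n), ℂ) where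
  toFun := fun u ↦ Δ u
  map_add' := fun u v ↦ by
    simp only [← TemperedDistribution.laplacianCLM_apply, map_add]
  map_smul' := fun c u ↦ by
    simp only [← TemperedDistribution.laplacianCLM_apply, map_smul, RingHom.id_apply]

/-- The polyharmonic operator `(-Δ)^l` in `L²(ℝⁿ)`: its domain consists of the `f ∈ L²` whose
distributional `(-Δ)^l f` is again in `L²`. -/
def polyharmonic (n l : ℕ) : L2 n →ₗ.[ℂ] L2 n where
  domain := (LinearMap.range (toDistr n)).comap (((-distrLaplacian n) ^ l) ∘ₗ toDistr n)
  toFun := (LinearEquiv.ofInjective (toDistr n) (toDistr_injective n)).symm.toLinearMap ∘ₗ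
    ((((-distrLaplacian n) ^ l) ∘ₗ toDistr n).restrict fun _ hf ↦ hf)

/-- The defining property of `polyharmonic`: `polyharmonic n l f` is the `L²` function
that represents the distribution `(-Δ)^l f`. -/
theorem toDistr_polyharmonic (n l : ℕ) (f : (polyharmonic n l).domain) :
    toDistr n (polyharmonic n l f) = ((-distrLaplacian n) ^ l) (toDistr n f) :=
  congrArg Subtype.val
    ((LinearEquiv.ofInjective (toDistr n) (toDistr_injective n)).apply_symm_apply
      ⟨((-distrLaplacian n) ^ l) (toDistr n f), f.2⟩)

/-- The functions `f ∈ L²(ℝⁿ)` that have a continuous representative vanishing at the origin. -/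
def vanishAtOrigin (n : ℕ) : Submodule ℂ (L2 n) where
  carrier := {f | ∃ g : EuclideanSpace ℝ (Fin n) → ℂ, Continuous g ∧ f =ᵐ[volume] g ∧ g 0 = 0}
  zero_mem' := ⟨0, continuous_zero, Lp.coeFn_zero _ _ _, rfl⟩
  add_mem' := by
    rintro f₁ f₂ ⟨g₁, hc₁, h₁, hz₁⟩ ⟨g₂, hc₂, h₂, hz₂⟩
    exact ⟨g₁ + g₂, hc₁.add hc₂, (Lp.coeFn_add f₁ f₂).trans (h₁.add h₂), by simp [hz₁, hz₂]⟩
  smul_mem' := by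
    rintro c f ⟨g, hc, h, hz⟩
    exact ⟨c • g, hc.const_smul c, (Lp.coeFn_smul c f).trans (h.const_smul c), by simp [hz]⟩

/-- The one-point restriction of `(-Δ)^l`, with domain `{f : f ∈ D((-Δ)^l), f(0) = 0}`. -/
def polyharmonicPoint (n l : ℕ) : L2 n →ₗ.[ℂ] L2 n :=
  (polyharmonic n l).domRestrict (vanishAtOrigin n)

end Position

end PointPerturbation

end

open PointPerturbation

noncomputable section

namespace PointPerturbation

/-! ### Resolvents at `-1` of non-negative self-adjoint operators -/

section Abstract

variable {H : Type*} [NormedAddCommGroup H] [InnerProductSpace ℂ H] 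

/-! Everything is read off from resolvents. Put `R = (I + A)⁻¹`. After diagonalization `A` is
multiplication by `p = b|k|^m` with `m = 2l`, and `∫ R h = ⟪g, h⟫` with `g = (1 + p)⁻¹`, which is
square integrable because `n < 2m`. A non-negative extension `B` has a symmetric resolvent `S` with
`0 ≤ S ≤ I` that agrees with `R` on `{g}ᗮ`, so `S = R + c⟪g, ·⟫g` with `c` real. Conversely, each
such injective `S` between `0` and `I` gives an extension (`mem_nonnegExtensions_iff`).

A negative `c` is possible iff the form of `R` dominates a positive multiple of `|⟪g, ·⟫|²`, and a
positive `c` iff the form of `I - R` does. By Cauchy–Schwarz and its extremal functions, `∫ w|f|²`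
dominates a multiple of `|∫ r f|²` iff `r²/w` is integrable (`dominatesRankOne_iff_integrable`). The
two criteria become integrability of `(1 + p)⁻¹`, decided at infinity and equivalent to `n < m`, and
of `p⁻¹(1 + p)⁻¹`, decided at the origin and equivalent to `m < n`. Hence only one sign of `c`
occurs when `n ≠ m`, and only `c = 0` when `n = m`.

The Fourier transform reduces the polyharmonic operator to the same situation: `f(0)` is the
integral of the Fourier transform of `f`. -/

theorem IsInverseOneAdd.injective {A : H →ₗ.[ℂ] H} {R : H →L[ℂ] H} (h : IsInverseOneAdd A R) :
    Function.Injective R := by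
  rw [injective_iff_map_eq_zero]
  intro y hy
  obtain ⟨x, hx, hxy⟩ := h.2 y
  have hx0 : x = 0 := by
    ext
    rw [hx, hy]; rfl
  rw [← hxy, hx0]
  simp

theorem IsInverseOneAdd.mem_domain_iff {A : H →ₗ.[ℂ] H} {R : H →L[ℂ] H}
    (h : IsInverseOneAdd A R) {x : H} : x ∈ A.domain ↔ ∃ y, R y = x := by
  constructor
  · intro hx
    exact ⟨_, h.1 ⟨x, hx⟩⟩
  · rintro ⟨y, rfl⟩
    obtain ⟨x, hx, -⟩ := h.2 y
    exact hx ▸ x.2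

theorem IsInverseOneAdd.apply_eq {A : H →ₗ.[ℂ] H} {R : H →L[ℂ] H}
    (h : IsInverseOneAdd A R) (x : A.domain) {y : H} (hy : R y = x) : A x = y - x := by
  have h1 := h.1 x
  rw [← hy] at h1
  have h2 := h.injective h1
  rw [hy] at h2
  rw [← h2, add_sub_cancel_left]

theorem IsInverseOneAdd.le {A B : H →ₗ.[ℂ] H} {R : H →L[ℂ] H}
    (hA : IsInverseOneAdd A R) (hB : IsInverseOneAdd B R) : A ≤ B := by
  refine ⟨fun x hx ↦ hB.mem_domain_iff.2 (hA.mem_domain_iff.1 hx), fun x y hxy ↦ ?_⟩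
  obtain ⟨z, hz⟩ := hA.mem_domain_iff.1 x.2
  rw [hA.apply_eq x hz, hB.apply_eq y (hz.trans hxy), hxy]

/-- An operator is determined by the inverse of `I + A`. -/
theorem IsInverseOneAdd.ext {A B : H →ₗ.[ℂ] H} {R : H →L[ℂ] H}
    (hA : IsInverseOneAdd A R) (hB : IsInverseOneAdd B R) : A = B :=
  le_antisymm (hA.le hB) (hB.le hA)

theorem IsInverseOneAdd.unique {A : H →ₗ.[ℂ] H} {R S : H →L[ℂ] H}
    (hR : IsInverseOneAdd A R) (hS : IsInverseOneAdd A S) : R = S := by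
  ext y
  obtain ⟨x, hx, hxy⟩ := hR.2 y
  rw [← hx, ← hxy, hS.1]

/-- The operator `S⁻¹ - I`, defined on the range of the injective operator `S`. -/
def inverseSubOne (S : H →L[ℂ] H) (hS : Function.Injective S) : H →ₗ.[ℂ] H where
  domain := LinearMap.range S.toLinearMap
  toFun := (LinearEquiv.ofInjective S.toLinearMap hS).symm.toLinearMap -
    (LinearMap.range S.toLinearMap).subtype

theorem isInverseOneAdd_inverseSubOne (S : H →L[ℂ] H) (hS : Function.Injective S) :
    IsInverseOneAdd (inverseSubOne S hS) S := by
  have key (x : (inverseSubOne S hS).domain) : (x : H) + inverseSubOne S hS x =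
      (LinearEquiv.ofInjective S.toLinearMap hS).symm x := add_sub_cancel _ _
  constructor
  · intro x
    rw [key]
    exact congrArg Subtype.val ((LinearEquiv.ofInjective S.toLinearMap hS).apply_symm_apply x)
  · intro h
    refine ⟨LinearEquiv.ofInjective S.toLinearMap hS h, rfl, (key _).trans ?_⟩
    exact (LinearEquiv.ofInjective S.toLinearMap hS).symm_apply_apply h

/-- The bounded operators that arise as `(I + A)⁻¹` for non-negative self-adjoint `A`, apart from
injectivity: the symmetric operators `S` with `0 ≤ S ≤ I`. -/
structure IsUnitInterval (S : H →L[ℂ] H) : Prop where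
  symm : ∀ x y, inner ℂ (S x) y = inner ℂ x (S y)
  nonneg : ∀ x, 0 ≤ (inner ℂ (S x) x).re
  le_one : ∀ x, (inner ℂ (S x) x).re ≤ ‖x‖ ^ 2

/-- This is `S² ≤ S`: add `0 ≤ S` tested at `x - S x` to `S ≤ I` tested at `S x`. -/
theorem IsUnitInterval.norm_sq_le {S : H →L[ℂ] H} (hS : IsUnitInterval S) (x : H) :
    ‖S x‖ ^ 2 ≤ (inner ℂ (S x) x).re := by
  have h1 := hS.nonneg (x - S x)
  have h2 := hS.le_one (S x)
  have e1 : inner ℂ (S (S x)) x = inner ℂ (S x) (S x) := hS.symm _ _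
  have e2 : (inner ℂ (S x) (S x)).re = ‖S x‖ ^ 2 := inner_self_eq_norm_sq (𝕜 := ℂ) _
  simp only [map_sub, inner_sub_left, inner_sub_right, Complex.sub_re, e1, e2] at h1
  linarith

theorem IsInverseOneAdd.isNonneg {A : H →ₗ.[ℂ] H} {R : H →L[ℂ] H}
    (h : IsInverseOneAdd A R) (hR : IsUnitInterval R) : IsNonneg A := by
  intro x
  obtain ⟨u, hu⟩ := h.mem_domain_iff.1 x.2
  have h1 := hR.norm_sq_le u
  have e2 : (inner ℂ (R u) (R u)).re = ‖R u‖ ^ 2 := inner_self_eq_norm_sq (𝕜 := ℂ) _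
  have e4 : (inner ℂ u (R u)).re = (inner ℂ (R u) u).re := inner_re_symm (𝕜 := ℂ) _ _
  rw [h.apply_eq x hu, ← hu, inner_sub_left, Complex.sub_re, e2, e4]
  linarith

variable [CompleteSpace H]

/-- The range of `R` is dense because `R` is symmetric and injective. For `y` in the adjoint domain,
symmetry gives `R (y + A* y) = y`, so `y` already lies in that range. -/
theorem IsInverseOneAdd.isSelfAdjoint {A : H →ₗ.[ℂ] H} {R : H →L[ℂ] H}
    (h : IsInverseOneAdd A R) (hR : IsUnitInterval R) : IsSelfAdjoint A := by
  have hdense : Dense (A.domain : Set H) := by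
    rw [Submodule.dense_iff_topologicalClosure_eq_top, ← Submodule.orthogonal_eq_bot_iff,
      Submodule.orthogonal_closure, Submodule.eq_bot_iff]
    intro y hy
    refine h.injective ?_
    rw [map_zero, ← inner_self_eq_zero (𝕜 := ℂ), hR.symm, ← inner_conj_symm,
      (Submodule.mem_orthogonal _ _).1 hy _ (h.mem_domain_iff.2 ⟨_, rfl⟩), map_zero]
  have hformal : A.IsFormalAdjoint A := by
    intro x y
    obtain ⟨u, hu⟩ := h.mem_domain_iff.1 x.2
    obtain ⟨v, hv⟩ := h.mem_domain_iff.1 y.2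
    rw [h.apply_eq x hu, h.apply_eq y hv, ← hu, ← hv, inner_sub_left, inner_sub_right, hR.symm,
      hR.symm u v]
  have key (y : A.adjoint.domain) : R (y + A.adjoint y) = y := by
    refine ext_inner_right ℂ fun u ↦ ?_
    have h1 := LinearPMap.adjoint_isFormalAdjoint hdense y ⟨R u, h.mem_domain_iff.2 ⟨u, rfl⟩⟩
    rw [h.apply_eq ⟨R u, h.mem_domain_iff.2 ⟨u, rfl⟩⟩ rfl] at h1
    simp only [inner_sub_right] at h1
    rw [hR.symm, inner_add_left, h1, add_sub_cancel]
  refine le_antisymm (a := A.adjoint) ⟨fun y hy ↦ h.mem_domain_iff.2 ⟨_, key ⟨y, hy⟩⟩, ?_⟩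
    (hformal.le_adjoint hdense)
  intro y x hyx
  rw [h.apply_eq x ((key y).trans hyx), hyx, add_sub_cancel_left]

/-- The hypothesis says `B* y = w`, and `B* = B`. This supplies both the density and the closedness
of the range of `I + B`. -/
theorem exists_apply_eq_of_isSelfAdjoint {B : H →ₗ.[ℂ] H} (hB : IsSelfAdjoint B) {y w : H}
    (h : ∀ z : B.domain, inner ℂ w (z : H) = inner ℂ y (B z)) :
    ∃ x : B.domain, (x : H) = y ∧ B x = w := by
  have hd := hB.dense_domain
  have h1 : B.adjoint = B := hB
  have h2 := LinearPMap.mem_adjoint_domain_of_exists y ⟨w, h⟩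
  have h3 := LinearPMap.adjoint_apply_eq hd ⟨y, h2⟩ h
  exact ⟨⟨y, h1.le.1 h2⟩, rfl, (h1.le.2 rfl).symm.trans h3⟩

theorem isFormalAdjoint_of_isSelfAdjoint {B : H →ₗ.[ℂ] H} (hB : IsSelfAdjoint B) :
    B.IsFormalAdjoint B := by
  have h := LinearPMap.adjoint_isFormalAdjoint hB.dense_domain
  rwa [show B.adjoint = B from hB] at h

/-- For a non-negative self-adjoint operator `B`, the map `I + B` is a bijection of the domain of
`B` onto the whole space, and its inverse is a symmetric operator between `0` and `I`. -/
theorem exists_isInverseOneAdd {B : H →ₗ.[ℂ] H} (hB : IsSelfAdjoint B) (hB0 : IsNonneg B) :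
    ∃ S : H →L[ℂ] H, IsInverseOneAdd B S ∧ IsUnitInterval S := by
  have hsym := isFormalAdjoint_of_isSelfAdjoint hB
  let T : B.domain →ₗ[ℂ] H := B.domain.subtype + B.toFun
  have hT (x : B.domain) : T x = (x : H) + B x := rfl
  have hre (x : B.domain) : ‖(x : H)‖ ^ 2 ≤ (inner ℂ (T x) (x : H)).re := by
    have h1 := hB0 x
    have h2 : (inner ℂ (x : H) (x : H)).re = ‖(x : H)‖ ^ 2 := inner_self_eq_norm_sq (𝕜 := ℂ) _
    rw [hT, inner_add_left, Complex.add_re, h2]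
    linarith
  have hbound (x : B.domain) : ‖(x : H)‖ ≤ ‖T x‖ := by
    have h1 : (inner ℂ (T x) (x : H)).re ≤ ‖T x‖ * ‖(x : H)‖ :=
      re_inner_le_norm (𝕜 := ℂ) _ _
    by_contra! hlt
    have := norm_nonneg (T x)
    nlinarith [hre x]
  have hinj : Function.Injective T := by
    rw [injective_iff_map_eq_zero]
    intro x hx
    have := hbound x
    rw [hx, norm_zero] at this
    exact Subtype.ext (norm_le_zero_iff.1 this)
  -- A vector `y` orthogonal to the range satisfies `B y = -y`, hence `T y = 0`.
  have hdense : Dense (LinearMap.range T : Set H) := by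
    rw [Submodule.dense_iff_topologicalClosure_eq_top, ← Submodule.orthogonal_eq_bot_iff,
      Submodule.orthogonal_closure, Submodule.eq_bot_iff]
    intro y hy
    obtain ⟨x, rfl, hx⟩ := exists_apply_eq_of_isSelfAdjoint hB (y := y) (w := -y) fun z ↦ by
      have h1 := (Submodule.mem_orthogonal' _ _).1 hy _ ⟨z, rfl⟩
      rw [hT, inner_add_right] at h1
      rw [inner_neg_left]
      exact neg_eq_of_add_eq_zero_right h1
    have h1 : T x = T 0 := by rw [map_zero, hT, hx, add_neg_cancel]
    rw [hinj h1]; rfl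
  -- By `hbound`, preimages of a convergent sequence are Cauchy; self-adjointness then puts their
  -- limit in the domain.
  have hclosed : IsClosed (LinearMap.range T : Set H) := by
    refine IsSeqClosed.isClosed fun u y hu hlim ↦ ?_
    choose x hx using hu
    have hcau : CauchySeq fun k ↦ (x k : H) := by
      have h1 := hlim.cauchySeq
      rw [Metric.cauchySeq_iff] at h1 ⊢
      intro ε hε
      obtain ⟨N, hN⟩ := h1 ε hε
      refine ⟨N, fun a ha b hb ↦ lt_of_le_of_lt ?_ (hN a ha b hb)⟩
      rw [dist_eq_norm, dist_eq_norm, ← hx, ← hx, ← map_sub]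
      exact hbound (x a - x b)
    obtain ⟨v, hv⟩ := cauchySeq_tendsto_of_complete hcau
    have hBx : Filter.Tendsto (fun k ↦ B (x k)) Filter.atTop (nhds (y - v)) := by
      refine (hlim.sub hv).congr fun k ↦ ?_
      rw [← hx, hT, add_sub_cancel_left]
    obtain ⟨w, hw, hBw⟩ := exists_apply_eq_of_isSelfAdjoint hB (y := v) (w := y - v) fun z ↦ by
      refine tendsto_nhds_unique (hBx.inner tendsto_const_nhds) ?_
      refine (hv.inner tendsto_const_nhds).congr fun k ↦ ?_
      exact (hsym (x k) z).symm
    exact ⟨w, by rw [hT, hw, hBw, add_sub_cancel]⟩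
  have hrange : LinearMap.range T = ⊤ :=
    SetLike.coe_injective (hclosed.closure_eq.symm.trans hdense.closure_eq)
  let e := LinearEquiv.ofBijective T ⟨hinj, LinearMap.range_eq_top.1 hrange⟩
  have he (x : B.domain) : e x = T x := rfl
  let S : H →L[ℂ] H := (B.domain.subtype ∘ₗ e.symm.toLinearMap).mkContinuous 1 fun y ↦ by
    have := hbound (e.symm y)
    rwa [← he, e.apply_symm_apply, ← one_mul ‖y‖] at this
  have hS (y : H) : S y = e.symm y := rfl
  have heS (y : H) : T (e.symm y) = y := e.apply_symm_apply y
  refine ⟨S, ⟨fun x ↦ ?_, fun y ↦ ⟨e.symm y, rfl, heS y⟩⟩, ⟨fun x y ↦ ?_, fun x ↦ ?_, fun x ↦ ?_⟩⟩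
  · rw [hS, ← hT, ← he, e.symm_apply_apply]
  · rw [hS, hS]
    nth_rw 2 [← heS x]
    nth_rw 1 [← heS y]
    rw [hT, hT, inner_add_left, inner_add_right, hsym]
  · have h1 := hre (e.symm x)
    rw [heS] at h1
    rw [hS]
    have e4 : (inner ℂ x (e.symm x : H)).re = (inner ℂ (e.symm x : H) x).re :=
      inner_re_symm (𝕜 := ℂ) _ _
    rw [← e4]
    exact (sq_nonneg _).trans h1
  · have h1 := hbound (e.symm x)
    rw [heS] at h1
    rw [hS]
    have h2 : (inner ℂ (e.symm x : H) x).re ≤ ‖(e.symm x : H)‖ * ‖x‖ :=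
      re_inner_le_norm (𝕜 := ℂ) _ _
    nlinarith [norm_nonneg x]

end Abstract

/-! ### Rank one perturbations of the resolvent and the abstract trichotomy -/

section Abstract

variable {H : Type*} [NormedAddCommGroup H] [InnerProductSpace ℂ H]

/-- The rank one perturbation `R + c ⟪g, ·⟫ g`. -/
def perturb (R : H →L[ℂ] H) (g : H) (c : ℝ) : H →L[ℂ] H :=
  R + (c : ℂ) • InnerProductSpace.rankOne ℂ g g

theorem perturb_apply (R : H →L[ℂ] H) (g : H) (c : ℝ) (x : H) :
    perturb R g c x = R x + ((c : ℂ) * inner ℂ g x) • g := by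
  simp [perturb, mul_smul]

theorem re_inner_perturb (R : H →L[ℂ] H) (g : H) (c : ℝ) (x : H) :
    (inner ℂ (perturb R g c x) x).re = (inner ℂ (R x) x).re + c * ‖inner ℂ g x‖ ^ 2 := by
  rw [perturb_apply, inner_add_left, inner_smul_left, Complex.add_re, map_mul, Complex.conj_ofReal,
    mul_assoc, ← Complex.normSq_eq_conj_mul_self, ← Complex.ofReal_mul, Complex.ofReal_re,
    Complex.normSq_eq_norm_sq]

theorem perturb_symm {R : H →L[ℂ] H} (hR : ∀ x y, inner ℂ (R x) y = inner ℂ x (R y)) (g : H)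
    (c : ℝ) (x y : H) : inner ℂ (perturb R g c x) y = inner ℂ x (perturb R g c y) := by
  rw [perturb_apply, perturb_apply, inner_add_left, inner_add_right, hR, inner_smul_left,
    inner_smul_right, map_mul, Complex.conj_ofReal, inner_conj_symm]
  ring

theorem perturb_sub_perturb (R : H →L[ℂ] H) (g : H) (c d : ℝ) :
    perturb R g c - perturb R g d = ((c - d : ℝ) : ℂ) • InnerProductSpace.rankOne ℂ g g := by
  rw [perturb, perturb, add_sub_add_left_eq_sub, ← sub_smul, Complex.ofReal_sub]

theorem perturb_zero (R : H →L[ℂ] H) (g : H) : perturb R g 0 = R := by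
  simp [perturb]

theorem perturb_injective (R : H →L[ℂ] H) {g : H} (hg : g ≠ 0) :
    Function.Injective (perturb R g) := by
  intro c d hcd
  have h := congrArg (fun T : H →L[ℂ] H ↦ (inner ℂ (T g) g).re) hcd
  simp only [re_inner_perturb, add_right_inj] at h
  exact mul_right_cancel₀ (by simpa using hg) h

theorem perturb_le_perturb (R : H →L[ℂ] H) (g : H) {c d : ℝ} (hcd : c ≤ d) :
    perturb R g c ≤ perturb R g d := by
  rw [ContinuousLinearMap.le_def, perturb_sub_perturb]
  exact (InnerProductSpace.isPositive_rankOne_self g).smul_of_nonneg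
    (by exact_mod_cast sub_nonneg.2 hcd)

/-- The quadratic form `q` dominates a positive multiple of `|⟪g, ·⟫|²`. -/
def DominatesRankOne (q : H → ℝ) (g : H) : Prop :=
  ∃ c : ℝ, 0 < c ∧ ∀ x, c * ‖inner ℂ g x‖ ^ 2 ≤ q x

/-- A symmetric operator vanishing on `{g}ᗮ` is a real multiple of `⟪g, ·⟫ g`. -/
theorem exists_eq_perturb {R S : H →L[ℂ] H} (hR : ∀ x y, inner ℂ (R x) y = inner ℂ x (R y))
    (hS : ∀ x y, inner ℂ (S x) y = inner ℂ x (S y)) {g : H} (hg : g ≠ 0)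
    (h : ∀ x, inner ℂ g x = 0 → S x = R x) : ∃ c : ℝ, S = perturb R g c := by
  let T := S - R
  have hT (x y) : inner ℂ (T x) y = inner ℂ x (T y) := by
    simp only [T, sub_apply, inner_sub_left, inner_sub_right, hR, hS]
  have hT0 {x : H} (hx : inner ℂ g x = 0) : T x = 0 := by
    simp only [T, sub_apply, h x hx, sub_self]
  have hgg : inner ℂ g g ≠ 0 := inner_self_eq_zero.not.2 hg
  -- The component `u` of `T g` orthogonal to `g` is killed by `T`, so `⟪u, u⟫ = ⟪u, T g⟫ = ⟪T u, g⟫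
  -- = 0`.
  have hTg : T g = (inner ℂ g (T g) / inner ℂ g g) • g := by
    have hu : inner ℂ g (T g - (inner ℂ g (T g) / inner ℂ g g) • g) = 0 := by
      rw [inner_sub_right, inner_smul_right, div_mul_cancel₀ _ hgg, sub_self]
    have hu' := hT0 hu
    rw [← sub_eq_zero, ← inner_self_eq_zero (𝕜 := ℂ)]
    refine (inner_sub_right _ _ _).trans ?_
    rw [inner_smul_right, ← hT, hu', inner_zero_left, inner_eq_zero_symm.1 hu, mul_zero,
      sub_zero]
  have hreal : ((inner ℂ g (T g)).re : ℂ) = inner ℂ g (T g) := by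
    rw [← Complex.conj_eq_iff_re, inner_conj_symm, hT]
  have hgg' : ((‖g‖ ^ 2 : ℝ) : ℂ) = inner ℂ g g := by
    rw [inner_self_eq_norm_sq_to_K]; simp
  -- One factor `‖g‖²` comes from projecting `x` onto `g`, the other from projecting `T g`.
  refine ⟨(inner ℂ g (T g)).re / ‖g‖ ^ 2 / ‖g‖ ^ 2, ?_⟩
  ext x
  have hx : T x = (inner ℂ g x / inner ℂ g g) • T g := by
    rw [← sub_eq_zero, ← map_smul, ← map_sub]
    apply hT0
    rw [inner_sub_right, inner_smul_right, div_mul_cancel₀ _ hgg, sub_self]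
  rw [hTg, smul_smul] at hx
  rw [perturb_apply, ← sub_eq_iff_eq_add', Complex.ofReal_div, Complex.ofReal_div, hreal, hgg']
  refine hx.trans ?_
  congr 1
  ring

theorem IsUnitInterval.injective_of_re_inner_pos {S : H →L[ℂ] H}
    (h : ∀ x, x ≠ 0 → 0 < (inner ℂ (S x) x).re) : Function.Injective S := by
  rw [injective_iff_map_eq_zero]
  intro x hx
  by_contra hx0
  have := h x hx0
  simp [hx] at this

/-- `A` with `(I + A)⁻¹ = R`, where `R` is symmetric with `0 ≤ R ≤ I`, and the restriction of `A`
to those `R h` in its domain with `⟪g, h⟫ = 0`. -/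
structure IsPointRestriction (A : H →ₗ.[ℂ] H) (R : H →L[ℂ] H) (g : H) (D : Submodule ℂ H) :
    Prop where
  inverse : IsInverseOneAdd A R
  unit : IsUnitInterval R
  ne_zero : g ≠ 0
  mem_iff : ∀ h, R h ∈ D ↔ inner ℂ g h = 0

theorem IsPointRestriction.re_inner_pos {A : H →ₗ.[ℂ] H} {R : H →L[ℂ] H} {g : H} {D : Submodule ℂ H}
    (h : IsPointRestriction A R g D) {x : H} (hx : x ≠ 0) :
    0 < (inner ℂ (R x) x).re := by
  refine lt_of_lt_of_le ?_ (h.unit.norm_sq_le x)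
  have := (map_ne_zero_iff R h.inverse.injective).2 hx
  positivity

/-- If `c < 0`, positivity of the perturbed form is exactly domination with constant `-c`. -/
theorem nonneg_of_not_dominates_inverse {R : H →L[ℂ] H} {g : H}
    (hd : ¬ DominatesRankOne (fun x ↦ (inner ℂ (R x) x).re) g) {c : ℝ}
    (hc : IsUnitInterval (perturb R g c)) : 0 ≤ c := by
  by_contra! hlt
  refine hd ⟨-c, neg_pos.2 hlt, fun x ↦ ?_⟩
  have := hc.nonneg x
  rw [re_inner_perturb] at this
  linarith

theorem nonpos_of_not_dominates_one_sub {R : H →L[ℂ] H} {g : H}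
    (hd : ¬ DominatesRankOne (fun x ↦ ‖x‖ ^ 2 - (inner ℂ (R x) x).re) g) {c : ℝ}
    (hc : IsUnitInterval (perturb R g c)) : c ≤ 0 := by
  by_contra! hlt
  refine hd ⟨c, hlt, fun x ↦ ?_⟩
  have := hc.le_one x
  rw [re_inner_perturb] at this
  linarith

variable [CompleteSpace H]

namespace IsPointRestriction

variable {A : H →ₗ.[ℂ] H} {R : H →L[ℂ] H} {g : H} {D : Submodule ℂ H}

theorem mem_nonnegExtensions (h : IsPointRestriction A R g D) :
    A ∈ nonnegExtensions (A.domRestrict D) :=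
  ⟨h.inverse.isSelfAdjoint h.unit, h.inverse.isNonneg h.unit, LinearPMap.domRestrict_le⟩

/-- The non-negative extensions are described by their resolvents `R + c ⟪g, ·⟫ g`. -/
theorem mem_nonnegExtensions_iff (h : IsPointRestriction A R g D) (B : H →ₗ.[ℂ] H) :
    B ∈ nonnegExtensions (A.domRestrict D) ↔
      ∃ c : ℝ, IsInverseOneAdd B (perturb R g c) ∧ IsUnitInterval (perturb R g c) := by
  constructor
  · rintro ⟨hB, hB0, hle⟩
    obtain ⟨S, hS, hSu⟩ := exists_isInverseOneAdd hB hB0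
    -- For `y ⟂ g` the vector `x = R y` lies in the restricted domain, where `B x = A x`; thus `(I +
    -- B) x = y` and `S y = x`.
    obtain ⟨c, rfl⟩ := exists_eq_perturb h.unit.symm hSu.symm h.ne_zero fun y hy ↦ by
      obtain ⟨x, hx, hxy⟩ := h.inverse.2 y
      have hxD : (x : H) ∈ (A.domRestrict D).domain := ⟨hx ▸ (h.mem_iff y).2 hy, x.2⟩
      have h1 : B ⟨x, hle.1 hxD⟩ = A x :=
        (hle.2 (x := ⟨x, hxD⟩) rfl).symm.trans (LinearPMap.domRestrict_le.2 rfl)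
      have h2 := hS.1 ⟨x, hle.1 hxD⟩
      rw [h1] at h2
      rw [← hx, ← h2, ← hxy]
    exact ⟨c, hS, hSu⟩
  · rintro ⟨c, hc, hcu⟩
    refine ⟨hc.isSelfAdjoint hcu, hc.isNonneg hcu, fun x hx ↦ ?_, fun x y hxy ↦ ?_⟩
    · obtain ⟨u, rfl⟩ := h.inverse.mem_domain_iff.1 hx.2
      have hu := (h.mem_iff u).1 hx.1
      exact hc.mem_domain_iff.2 ⟨u, by rw [perturb_apply, hu, mul_zero, zero_smul, add_zero]⟩
    · have hx : (x : H) ∈ A.domain := x.2.2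
      obtain ⟨u, hu⟩ := h.inverse.mem_domain_iff.1 hx
      have hu0 := (h.mem_iff u).1 (hu ▸ x.2.1)
      have h1 : A.domRestrict D x = A ⟨x, hx⟩ := LinearPMap.domRestrict_le.2 rfl
      rw [h1, h.inverse.apply_eq ⟨x, hx⟩ hu, hc.apply_eq y (y := u), hxy]
      rw [perturb_apply, hu0, mul_zero, zero_smul, add_zero, hu, hxy]

/-- The parameters `t = 1/(k + 2)` already give infinitely many operators, since the resolvent
determines both the operator and `c`. -/
theorem perturbation_infinite (h : IsPointRestriction A R g D) {s : ℝ} (hs : s ≠ 0)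
    (hu : ∀ t : ℝ, 0 < t → t < 1 → IsUnitInterval (perturb R g (t * s)) ∧
      Function.Injective (perturb R g (t * s))) :
    (nonnegSingularPerturbations A (A.domRestrict D)).Infinite := by
  have ht (k : ℕ) : (0 : ℝ) < 1 / (k + 2) ∧ (1 : ℝ) / (k + 2) < 1 := by
    refine ⟨by positivity, (div_lt_one (by positivity)).2 ?_⟩
    have : (0 : ℝ) ≤ k := k.cast_nonneg
    linarith
  let f (k : ℕ) : H →ₗ.[ℂ] H := inverseSubOne _ (hu _ (ht k).1 (ht k).2).2
  have hf (k : ℕ) : IsInverseOneAdd (f k) (perturb R g (1 / (k + 2) * s)) :=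
    isInverseOneAdd_inverseSubOne _ _
  refine Set.infinite_of_injective_forall_mem (f := f) (fun j k hjk ↦ ?_) fun k ↦ ⟨?_, fun hk ↦ ?_⟩
  · have h1 := hf j
    rw [hjk] at h1
    have h2 := mul_right_cancel₀ hs (perturb_injective R h.ne_zero (h1.unique (hf k)))
    simpa using h2
  · exact (h.mem_nonnegExtensions_iff _).2 ⟨_, hf k, (hu _ (ht k).1 (ht k).2).1⟩
  · have h1 := hf k
    rw [hk] at h1
    have h2 := perturb_injective R h.ne_zero
      ((h1.unique h.inverse).trans (perturb_zero R g).symm)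
    exact mul_ne_zero (ht k).1.ne' hs h2

/-- Subtracting `t c |⟪g, ·⟫|²` with `t < 1` leaves at least `(1 - t)` times the form of `R`, which
is strictly positive; this keeps the new resolvent injective. -/
theorem infinite_of_dominates_inverse (h : IsPointRestriction A R g D)
    (hd : DominatesRankOne (fun x ↦ (inner ℂ (R x) x).re) g) :
    (nonnegSingularPerturbations A (A.domRestrict D)).Infinite := by
  obtain ⟨c, hc, hcx⟩ := hd
  refine h.perturbation_infinite (s := -c) (neg_ne_zero.2 hc.ne') fun t ht0 ht1 ↦
    ⟨⟨perturb_symm h.unit.symm g _, fun x ↦ ?_, fun x ↦ ?_⟩,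
      IsUnitInterval.injective_of_re_inner_pos fun x hx ↦ ?_⟩
  all_goals
    rw [re_inner_perturb]
    have h1 : c * ‖inner ℂ g x‖ ^ 2 ≤ (inner ℂ (R x) x).re := hcx x
    have h2 := h.unit.nonneg x
    have h3 := h.unit.le_one x
    have h4 : 0 ≤ c * ‖inner ℂ g x‖ ^ 2 := by positivity
  · nlinarith
  · nlinarith
  · have := h.re_inner_pos hx
    nlinarith

theorem infinite_of_dominates_one_sub (h : IsPointRestriction A R g D)
    (hd : DominatesRankOne (fun x ↦ ‖x‖ ^ 2 - (inner ℂ (R x) x).re) g) :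
    (nonnegSingularPerturbations A (A.domRestrict D)).Infinite := by
  obtain ⟨c, hc, hcx⟩ := hd
  refine h.perturbation_infinite hc.ne' fun t ht0 ht1 ↦
    ⟨⟨perturb_symm h.unit.symm g _, fun x ↦ ?_, fun x ↦ ?_⟩,
      IsUnitInterval.injective_of_re_inner_pos fun x hx ↦ ?_⟩
  all_goals
    rw [re_inner_perturb]
    have h1 : c * ‖inner ℂ g x‖ ^ 2 ≤ ‖x‖ ^ 2 - (inner ℂ (R x) x).re := hcx x
    have h2 := h.unit.nonneg x
    have h4 : 0 ≤ c * ‖inner ℂ g x‖ ^ 2 := by positivity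
  · nlinarith
  · nlinarith
  · have := h.re_inner_pos hx
    nlinarith

/-- Only `c ≤ 0` is admissible, so every resolvent lies below `R`; the order on operators is the
reverse one. -/
theorem isMinimalElement (h : IsPointRestriction A R g D)
    (hd : ¬ DominatesRankOne (fun x ↦ ‖x‖ ^ 2 - (inner ℂ (R x) x).re) g) :
    IsMinimalElement (nonnegExtensions (A.domRestrict D)) A := by
  refine ⟨h.mem_nonnegExtensions, fun B hB ↦ ?_⟩
  obtain ⟨c, hc, hcu⟩ := (h.mem_nonnegExtensions_iff B).1 hB
  refine ⟨R, _, h.inverse, hc, ?_⟩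
  have := perturb_le_perturb R g (nonpos_of_not_dominates_one_sub hd hcu)
  rwa [perturb_zero] at this

theorem isMaximalElement (h : IsPointRestriction A R g D)
    (hd : ¬ DominatesRankOne (fun x ↦ (inner ℂ (R x) x).re) g) :
    IsMaximalElement (nonnegExtensions (A.domRestrict D)) A := by
  refine ⟨h.mem_nonnegExtensions, fun B hB ↦ ?_⟩
  obtain ⟨c, hc, hcu⟩ := (h.mem_nonnegExtensions_iff B).1 hB
  refine ⟨_, R, hc, h.inverse, ?_⟩
  have := perturb_le_perturb R g (nonneg_of_not_dominates_inverse hd hcu)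
  rwa [perturb_zero] at this

theorem singularPerturbations_eq_empty (h : IsPointRestriction A R g D)
    (hd : ¬ DominatesRankOne (fun x ↦ (inner ℂ (R x) x).re) g)
    (hd' : ¬ DominatesRankOne (fun x ↦ ‖x‖ ^ 2 - (inner ℂ (R x) x).re) g) :
    nonnegSingularPerturbations A (A.domRestrict D) = ∅ := by
  rw [Set.eq_empty_iff_forall_notMem]
  rintro B ⟨hB, hne⟩
  obtain ⟨c, hc, hcu⟩ := (h.mem_nonnegExtensions_iff B).1 hB
  obtain rfl : c = 0 := le_antisymm (nonpos_of_not_dominates_one_sub hd' hcu)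
    (nonneg_of_not_dominates_inverse hd hcu)
  rw [perturb_zero] at hc
  exact hne (hc.ext h.inverse)

/-- The trichotomy for the non-negative extensions of a point restriction. -/
theorem trichotomy (h : IsPointRestriction A R g D) {n m : ℕ}
    (h1 : DominatesRankOne (fun x ↦ (inner ℂ (R x) x).re) g ↔ n < m)
    (h2 : DominatesRankOne (fun x ↦ ‖x‖ ^ 2 - (inner ℂ (R x) x).re) g ↔ m < n) :
    A ∈ nonnegExtensions (A.domRestrict D) ∧
      (n < m → (nonnegSingularPerturbations A (A.domRestrict D)).Infinite ∧
        IsMinimalElement (nonnegExtensions (A.domRestrict D)) A) ∧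
      (n = m → nonnegSingularPerturbations A (A.domRestrict D) = ∅) ∧
      (m < n → (nonnegSingularPerturbations A (A.domRestrict D)).Infinite ∧
        IsMaximalElement (nonnegExtensions (A.domRestrict D)) A) :=
  ⟨h.mem_nonnegExtensions,
    fun hlt ↦ ⟨h.infinite_of_dominates_inverse (h1.2 hlt), h.isMinimalElement (by rw [h2]; omega)⟩,
    fun he ↦ h.singularPerturbations_eq_empty (by rw [h1]; omega) (by rw [h2]; omega),
    fun hlt ↦ ⟨h.infinite_of_dominates_one_sub (h2.2 hlt), h.isMaximalElement (by rw [h1]; omega)⟩⟩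

end IsPointRestriction

end Abstract

/-! ### Multiplication operators on `L²` and the domination criterion -/

section Multiplication

variable {α : Type*} [MeasurableSpace α] {μ : Measure α}

theorem memLp_mul_of_abs_le_one {r : α → ℝ} (hr : Measurable r) (hr1 : ∀ x, |r x| ≤ 1)
    {f : α → ℂ} (hf : MemLp f 2 μ) : MemLp (fun x ↦ (r x : ℂ) * f x) 2 μ := by
  refine hf.of_le ((Complex.measurable_ofReal.comp hr).aestronglyMeasurable.mul hf.1) ?_
  refine Filter.Eventually.of_forall fun x ↦ ?_
  rw [norm_mul, Complex.norm_real, Real.norm_eq_abs]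
  exact mul_le_of_le_one_left (norm_nonneg _) (hr1 x)

theorem norm_toLp_sq {f : α → ℂ} (hf : MemLp f 2 μ) : ‖hf.toLp f‖ ^ 2 = ∫ x, ‖f x‖ ^ 2 ∂μ := by
  have h : ((‖hf.toLp f‖ ^ 2 : ℝ) : ℂ) = ((∫ x, ‖f x‖ ^ 2 ∂μ : ℝ) : ℂ) := by
    have h1 := inner_self_eq_norm_sq_to_K (𝕜 := ℂ) (hf.toLp f)
    rw [Complex.ofReal_pow]
    refine h1.symm.trans ?_
    rw [L2.inner_def, ← integral_complex_ofReal]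
    refine integral_congr_ae ?_
    filter_upwards [hf.coeFn_toLp] with x hx
    rw [hx, inner_self_eq_norm_sq_to_K]
    simp
  exact_mod_cast h

theorem norm_sq_eq_integral (f : Lp ℂ 2 μ) : ‖f‖ ^ 2 = ∫ x, ‖f x‖ ^ 2 ∂μ := by
  rw [← norm_toLp_sq (Lp.memLp f), Lp.toLp_coeFn]

/-- Multiplication by a function `r` with `|r| ≤ 1`, as a bounded operator on `L²`. -/
def mulBounded (μ : Measure α) (r : α → ℝ) (hr : Measurable r) (hr1 : ∀ x, |r x| ≤ 1) :
    Lp ℂ 2 μ →L[ℂ] Lp ℂ 2 μ :=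
  LinearMap.mkContinuous
    { toFun := fun f ↦ (memLp_mul_of_abs_le_one hr hr1 (Lp.memLp f)).toLp _
      map_add' := fun f g ↦ by
        rw [← MemLp.toLp_add]
        refine MemLp.toLp_congr _ _ ?_
        filter_upwards [Lp.coeFn_add f g] with x hx
        rw [hx, Pi.add_apply, Pi.add_apply, mul_add]
      map_smul' := fun c f ↦ by
        rw [RingHom.id_apply, ← MemLp.toLp_const_smul]
        refine MemLp.toLp_congr _ _ ?_
        filter_upwards [Lp.coeFn_smul c f] with x hx
        rw [hx, Pi.smul_apply, Pi.smul_apply, smul_eq_mul, smul_eq_mul, mul_left_comm] } 1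
    fun f ↦ by
      rw [one_mul]
      refine Lp.norm_le_norm_of_ae_le ?_
      filter_upwards [(memLp_mul_of_abs_le_one hr hr1 (Lp.memLp f)).coeFn_toLp] with x hx
      refine (congrArg norm hx).trans_le ?_
      rw [norm_mul, Complex.norm_real, Real.norm_eq_abs]
      exact mul_le_of_le_one_left (norm_nonneg _) (hr1 x)

variable {r : α → ℝ} {hr : Measurable r} {hr1 : ∀ x, |r x| ≤ 1}

theorem coeFn_mulBounded (f : Lp ℂ 2 μ) :
    mulBounded μ r hr hr1 f =ᵐ[μ] fun x ↦ (r x : ℂ) * f x :=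
  (memLp_mul_of_abs_le_one hr hr1 (Lp.memLp f)).coeFn_toLp

theorem mulBounded_symm (f g : Lp ℂ 2 μ) :
    inner ℂ (mulBounded μ r hr hr1 f) g = inner ℂ f (mulBounded μ r hr hr1 g) := by
  rw [L2.inner_def, L2.inner_def]
  refine integral_congr_ae ?_
  filter_upwards [coeFn_mulBounded (hr := hr) (hr1 := hr1) f,
    coeFn_mulBounded (hr := hr) (hr1 := hr1) g] with x hf hg
  rw [hf, hg, ← smul_eq_mul, ← smul_eq_mul, inner_smul_left, inner_smul_right, Complex.conj_ofReal]

theorem re_inner_mulBounded (f : Lp ℂ 2 μ) :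
    (inner ℂ (mulBounded μ r hr hr1 f) f).re = ∫ x, r x * ‖f x‖ ^ 2 ∂μ := by
  rw [← Complex.ofReal_re (∫ x, r x * ‖f x‖ ^ 2 ∂μ), ← integral_complex_ofReal, L2.inner_def]
  congr 1
  refine integral_congr_ae ?_
  filter_upwards [coeFn_mulBounded (hr := hr) (hr1 := hr1) f] with x hf
  rw [hf, ← smul_eq_mul, inner_smul_left, Complex.conj_ofReal, inner_self_eq_norm_sq_to_K]
  simp

theorem integrable_norm_sq (f : Lp ℂ 2 μ) : Integrable (fun x ↦ ‖f x‖ ^ 2) μ :=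
  (Lp.memLp f).integrable_norm_pow (p := 2) two_ne_zero

theorem integrable_mul_norm_sq (hr : Measurable r) (hr1 : ∀ x, |r x| ≤ 1) (f : Lp ℂ 2 μ) :
    Integrable (fun x ↦ r x * ‖f x‖ ^ 2) μ := by
  refine (integrable_norm_sq f).mono (hr.aestronglyMeasurable.mul (integrable_norm_sq f).1)
    (Filter.Eventually.of_forall fun x ↦ ?_)
  rw [norm_mul, Real.norm_eq_abs]
  exact mul_le_of_le_one_left (norm_nonneg _) (hr1 x)

theorem norm_sq_sub_re_inner_mulBounded (f : Lp ℂ 2 μ) :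
    ‖f‖ ^ 2 - (inner ℂ (mulBounded μ r hr hr1 f) f).re = ∫ x, (1 - r x) * ‖f x‖ ^ 2 ∂μ := by
  rw [re_inner_mulBounded, norm_sq_eq_integral,
    ← integral_sub (integrable_norm_sq f) (integrable_mul_norm_sq hr hr1 f)]
  simp only [sub_mul, one_mul]

theorem isUnitInterval_mulBounded (hr0 : ∀ x, 0 ≤ r x) :
    IsUnitInterval (mulBounded μ r hr hr1) where
  symm := mulBounded_symm
  nonneg f := by
    rw [re_inner_mulBounded]
    exact integral_nonneg fun x ↦ mul_nonneg (hr0 x) (sq_nonneg _)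
  le_one f := by
    rw [← sub_nonneg, norm_sq_sub_re_inner_mulBounded]
    exact integral_nonneg fun x ↦
      mul_nonneg (sub_nonneg.2 ((le_abs_self _).trans (hr1 x))) (sq_nonneg _)

theorem inner_toLp_ofReal (hg : MemLp (fun x ↦ (r x : ℂ)) 2 μ) (f : Lp ℂ 2 μ) :
    inner ℂ (hg.toLp _) f = ∫ x, (r x : ℂ) * f x ∂μ := by
  rw [L2.inner_def]
  refine integral_congr_ae ?_
  filter_upwards [hg.coeFn_toLp] with x hx
  rw [hx, RCLike.inner_apply, Complex.conj_ofReal, mul_comm]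

/-- The form `∫ w |f|²` dominates a multiple of `|∫ r f|²` if `r² / w` is integrable. -/
theorem dominatesRankOne_of_integrable {w : α → ℝ} (hr : Measurable r) (hw : Measurable w)
    (hw0 : ∀ᵐ x ∂μ, 0 < w x) (hw1 : ∀ x, |w x| ≤ 1) (hg : MemLp (fun x ↦ (r x : ℂ)) 2 μ)
    (h : Integrable (fun x ↦ r x ^ 2 / w x) μ) :
    DominatesRankOne (fun f : Lp ℂ 2 μ ↦ ∫ x, w x * ‖f x‖ ^ 2 ∂μ) (hg.toLp _) := by
  have hu : MemLp (fun x ↦ ((r x / √(w x) : ℝ) : ℂ)) 2 μ := by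
    have hm : Measurable fun x ↦ r x / √(w x) := hr.div hw.sqrt
    refine MemLp.ofReal ((memLp_two_iff_integrable_sq hm.aestronglyMeasurable).2 (h.congr ?_))
    filter_upwards [hw0] with x hx
    rw [div_pow, Real.sq_sqrt hx.le]
  -- Cauchy–Schwarz for `∫ r f = ∫ (r/√w)(√w f)`; the added `1` keeps the constant meaningful when
  -- `r/√w` vanishes.
  refine ⟨1 / (1 + ‖hu.toLp _‖ ^ 2), by positivity, fun f ↦ ?_⟩
  beta_reduce
  have hs1 (x : α) : |√(w x)| ≤ 1 := by
    rw [abs_of_nonneg (Real.sqrt_nonneg _)]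
    exact Real.sqrt_le_iff.2 ⟨zero_le_one, by simpa using (le_abs_self _).trans (hw1 x)⟩
  let v := mulBounded μ (fun x ↦ √(w x)) hw.sqrt hs1 f
  have hv : ‖v‖ ^ 2 = ∫ x, w x * ‖f x‖ ^ 2 ∂μ := by
    rw [norm_sq_eq_integral]
    refine integral_congr_ae ?_
    filter_upwards [coeFn_mulBounded (hr := hw.sqrt) (hr1 := hs1) f, hw0] with x hx hx0
    rw [hx, norm_mul, mul_pow, Complex.norm_real, Real.norm_eq_abs, sq_abs, Real.sq_sqrt hx0.le]
  have hin : inner ℂ (hg.toLp _) f = inner ℂ (hu.toLp _) v := by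
    rw [inner_toLp_ofReal, inner_toLp_ofReal]
    refine integral_congr_ae ?_
    filter_upwards [coeFn_mulBounded (hr := hw.sqrt) (hr1 := hs1) f, hw0] with x hx hx0
    rw [hx, ← mul_assoc, ← Complex.ofReal_mul, div_mul_cancel₀ _ (Real.sqrt_pos.2 hx0).ne']
  have hcs : ‖inner ℂ (hu.toLp _) v‖ ^ 2 ≤ ‖hu.toLp _‖ ^ 2 * ‖v‖ ^ 2 := by
    rw [← mul_pow]
    exact pow_le_pow_left₀ (norm_nonneg _) (norm_inner_le_norm _ _) 2
  rw [hin, ← hv, div_mul_eq_mul_div, one_mul, div_le_iff₀ (by positivity)]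
  nlinarith [sq_nonneg ‖v‖]

/-- If the form `∫ w |f|²` dominates a multiple of `|∫ r f|²`, then `r² / w` is integrable. -/
theorem integrable_of_dominatesRankOne [SigmaFinite μ] {w : α → ℝ} (hr : Measurable r)
    (hr1 : ∀ x, |r x| ≤ 1) (hw : Measurable w)
    (hw0 : ∀ᵐ x ∂μ, 0 < w x) (hg : MemLp (fun x ↦ (r x : ℂ)) 2 μ)
    (h : DominatesRankOne (fun f : Lp ℂ 2 μ ↦ ∫ x, w x * ‖f x‖ ^ 2 ∂μ) (hg.toLp _)) :
    Integrable (fun x ↦ r x ^ 2 / w x) μ := by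
  obtain ⟨c, hc, hcf⟩ := h
  -- The extremal function `r/w` need not be in `L²`; on `E N`, of finite measure and with `w`
  -- bounded below, it is bounded.
  let E (N : ℕ) : Set α := spanningSets μ N ∩ {x | 1 / ((N : ℝ) + 1) ≤ w x}
  have hEm (N : ℕ) : MeasurableSet (E N) :=
    (measurableSet_spanningSets μ N).inter (measurableSet_le measurable_const hw)
  have hEfin (N : ℕ) : μ (E N) ≠ ⊤ :=
    ((measure_mono Set.inter_subset_left).trans_lt (measure_spanningSets_lt_top μ N)).ne
  have hcover : AECover μ Filter.atTop E := by
    refine ⟨?_, hEm⟩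
    filter_upwards [hw0] with x hx
    obtain ⟨M, hM⟩ := exists_nat_one_div_lt hx
    filter_upwards [Filter.eventually_ge_atTop (spanningSetsIndex μ x),
      Filter.eventually_ge_atTop M] with N hN hN'
    refine ⟨mem_spanningSets_of_index_le _ _ hN, le_trans ?_ hM.le⟩
    exact one_div_le_one_div_of_le (by positivity) (by exact_mod_cast Nat.succ_le_succ hN')
  have hwE {N : ℕ} {x : α} (hx : x ∈ E N) : 0 < w x := lt_of_lt_of_le (by positivity) hx.2
  have hb (N : ℕ) {x : α} (hx : x ∈ E N) : ‖r x / w x‖ ≤ N + 1 := by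
    have h1 : 1 / ((N : ℝ) + 1) ≤ w x := hx.2
    rw [norm_div, Real.norm_eq_abs, Real.norm_eq_abs, abs_of_pos (hwE hx), div_le_iff₀ (hwE hx)]
    rw [div_le_iff₀ (by positivity)] at h1
    linarith [hr1 x]
  have hint (N : ℕ) : IntegrableOn (fun x ↦ r x ^ 2 / w x) (E N) μ := by
    refine Measure.integrableOn_of_bounded (M := (N : ℝ) + 1) (hEfin N)
      ((hr.pow_const 2).div hw).aestronglyMeasurable ?_
    filter_upwards [ae_restrict_mem (hEm N)] with x hx
    rw [sq, mul_div_assoc, norm_mul]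
    exact (mul_le_of_le_one_left (norm_nonneg _) (hr1 x)).trans (hb N hx)
  refine hcover.integrable_of_integral_bounded_of_nonneg_ae (1 / c) hint ?_ ?_
  · filter_upwards [hw0] with x hx
    exact div_nonneg (sq_nonneg _) hx.le
  refine Filter.Eventually.of_forall fun N ↦ ?_
  have hmem : MemLp ((E N).indicator fun x ↦ ((r x / w x : ℝ) : ℂ)) 2 μ := by
    rw [memLp_indicator_iff_restrict (hEm N)]
    have : IsFiniteMeasure (μ.restrict (E N)) := ⟨by simpa using (hEfin N).lt_top⟩
    refine MemLp.of_bound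
      (Complex.measurable_ofReal.comp (hr.div hw)).aestronglyMeasurable ((N : ℝ) + 1) ?_
    filter_upwards [ae_restrict_mem (hEm N)] with x hx
    rw [Complex.norm_real]
    exact hb N hx
  have h1 : inner ℂ (hg.toLp _) (hmem.toLp _) = ((∫ x in E N, r x ^ 2 / w x ∂μ : ℝ) : ℂ) := by
    rw [inner_toLp_ofReal, ← integral_complex_ofReal, ← integral_indicator (hEm N)]
    refine integral_congr_ae ?_
    filter_upwards [hmem.coeFn_toLp] with x hx
    rw [hx]
    by_cases hxE : x ∈ E N
    · rw [Set.indicator_of_mem hxE, Set.indicator_of_mem hxE, ← Complex.ofReal_mul]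
      congr 1
      ring
    · rw [Set.indicator_of_notMem hxE, Set.indicator_of_notMem hxE, mul_zero]
  have h2 : ∫ x, w x * ‖hmem.toLp _ x‖ ^ 2 ∂μ = ∫ x in E N, r x ^ 2 / w x ∂μ := by
    rw [← integral_indicator (hEm N)]
    refine integral_congr_ae ?_
    filter_upwards [hmem.coeFn_toLp] with x hx
    rw [hx]
    by_cases hxE : x ∈ E N
    · have := (hwE hxE).ne'
      rw [Set.indicator_of_mem hxE, Set.indicator_of_mem hxE, Complex.norm_real, Real.norm_eq_abs,
        sq_abs]
      field_simp
    · rw [Set.indicator_of_notMem hxE, Set.indicator_of_notMem hxE, norm_zero]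
      ring
  -- With `J = ∫_{E N} r²/w` this reads `c J² ≤ J`, so `J ≤ 1/c` uniformly in `N`.
  have h3 : c * ‖inner ℂ (hg.toLp _) (hmem.toLp _)‖ ^ 2 ≤ ∫ x, w x * ‖hmem.toLp _ x‖ ^ 2 ∂μ :=
    hcf (hmem.toLp _)
  rw [h1, h2, Complex.norm_real, Real.norm_eq_abs, sq_abs] at h3
  rw [le_div_iff₀ hc]
  by_contra! hlt
  have h4 : 0 < ∫ x in E N, r x ^ 2 / w x ∂μ := by
    by_contra! hle
    nlinarith
  nlinarith

theorem dominatesRankOne_iff_integrable [SigmaFinite μ] {w : α → ℝ} (hr : Measurable r)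
    (hr1 : ∀ x, |r x| ≤ 1) (hw : Measurable w) (hw0 : ∀ᵐ x ∂μ, 0 < w x) (hw1 : ∀ x, |w x| ≤ 1)
    (hg : MemLp (fun x ↦ (r x : ℂ)) 2 μ) :
    DominatesRankOne (fun f : Lp ℂ 2 μ ↦ ∫ x, w x * ‖f x‖ ^ 2 ∂μ) (hg.toLp _) ↔
      Integrable (fun x ↦ r x ^ 2 / w x) μ :=
  ⟨integrable_of_dominatesRankOne hr hr1 hw hw0 hg,
    dominatesRankOne_of_integrable hr hw hw0 hw1 hg⟩

end Multiplication

/-! ### Convergence of the radial integrals -/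

section Radial

open Set

theorem integrableOn_Ioi_of_bounds {f : ℝ → ℝ} (hf : Measurable f) {C : ℝ}
    (h0 : ∀ y, 0 < y → y ≤ 1 → |f y| ≤ C) (h1 : ∀ y, 1 < y → |f y| ≤ C * y ^ (-2 : ℝ)) :
    IntegrableOn f (Ioi 0) := by
  rw [← Ioc_union_Ioi_eq_Ioi zero_le_one]
  refine IntegrableOn.union ?_ ?_
  · refine Measure.integrableOn_of_bounded (M := C) (by simp) hf.aestronglyMeasurable ?_
    filter_upwards [ae_restrict_mem measurableSet_Ioc] with y hy
    exact h0 y hy.1 hy.2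
  · refine ((integrableOn_Ioi_rpow_of_lt (a := -2) (by norm_num) one_pos).const_mul C).mono'
      hf.aestronglyMeasurable ?_
    filter_upwards [ae_restrict_mem measurableSet_Ioi] with y hy
    exact h1 y hy

theorem not_integrableOn_Ioi_of_inv_le_at_top {f : ℝ → ℝ} {c : ℝ} (hc : 0 < c)
    (h : ∀ y, 1 < y → c * y⁻¹ ≤ f y) : ¬ IntegrableOn f (Ioi 0) := by
  intro hf
  refine not_integrableOn_Ioi_inv (a := 1) ?_
  refine ((hf.mono_set (Ioi_subset_Ioi zero_le_one)).const_mul c⁻¹).mono'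
    measurable_inv.aestronglyMeasurable ?_
  filter_upwards [ae_restrict_mem measurableSet_Ioi] with y hy
  have hy0 : 0 < y := one_pos.trans hy
  rw [Real.norm_eq_abs, abs_of_pos (inv_pos.2 hy0), ← div_eq_inv_mul, le_div_iff₀' hc]
  exact h y hy

theorem not_integrableOn_Ioi_of_inv_le_at_zero {f : ℝ → ℝ} {c : ℝ} (hc : 0 < c)
    (h : ∀ y, 0 < y → y ≤ 1 → c * y⁻¹ ≤ f y) : ¬ IntegrableOn f (Ioi 0) := by
  intro hf
  have h1 : IntervalIntegrable (fun y : ℝ ↦ y⁻¹) volume 0 1 := by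
    rw [intervalIntegrable_iff_integrableOn_Ioc_of_le zero_le_one]
    refine ((hf.mono_set (Ioc_subset_Ioi_self)).const_mul c⁻¹).mono'
      measurable_inv.aestronglyMeasurable ?_
    filter_upwards [ae_restrict_mem measurableSet_Ioc] with y hy
    rw [Real.norm_eq_abs, abs_of_pos (inv_pos.2 hy.1), ← div_eq_inv_mul, le_div_iff₀' hc]
    exact h y hy.1 hy.2
  rw [intervalIntegrable_inv_iff] at h1
  simp at h1

theorem integrable_norm_iff_integrableOn_Ioi {n : ℕ} (hn : 1 ≤ n) (f : ℝ → ℝ) :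
    Integrable (fun k : EuclideanSpace ℝ (Fin n) ↦ f ‖k‖) ↔
      IntegrableOn (fun y ↦ y ^ (n - 1) * f y) (Ioi 0) := by
  have : Nontrivial (EuclideanSpace ℝ (Fin n)) := by
    have : Nonempty (Fin n) := ⟨⟨0, hn⟩⟩
    infer_instance
  have h := integrable_fun_norm_addHaar (volume : Measure (EuclideanSpace ℝ (Fin n))) (f := f)
  simpa using h

/-- Since exponents are integers, any convergent tail decays at least like `y⁻²`. -/
theorem pow_div_le_rpow_neg_two {d m : ℕ} (h : d + 2 ≤ m) {y : ℝ} (hy : 1 < y) :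
    y ^ d / y ^ m ≤ y ^ (-2 : ℝ) := by
  have hy0 : 0 < y := one_pos.trans hy
  rw [Real.rpow_neg hy0.le, Real.rpow_two, div_le_iff₀ (by positivity), ← div_eq_inv_mul,
    le_div_iff₀ (by positivity), ← pow_add]
  exact pow_le_pow_right₀ hy.le h

variable {n m : ℕ} {b : ℝ}

/-- The case `j = 2` puts `g` in `L²`; `j = 1` is half of the first criterion. -/
theorem integrable_inv_one_add_pow (hn : 1 ≤ n) (hb : 0 < b) {j : ℕ} (h : n < j * m) :
    Integrable fun k : EuclideanSpace ℝ (Fin n) ↦ (1 + b * ‖k‖ ^ m)⁻¹ ^ j := by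
  rw [integrable_norm_iff_integrableOn_Ioi hn fun y ↦ (1 + b * y ^ m)⁻¹ ^ j]
  refine integrableOn_Ioi_of_bounds (C := 1 + (b⁻¹) ^ j) (by fun_prop) (fun y hy hy1 ↦ ?_)
    fun y hy ↦ ?_
  · have h1 : y ^ (n - 1) ≤ 1 := pow_le_one₀ hy.le hy1
    have h2 : (1 + b * y ^ m)⁻¹ ^ j ≤ 1 :=
      pow_le_one₀ (by positivity) (inv_le_one_of_one_le₀ (by simp; positivity))
    rw [abs_of_nonneg (by positivity)]
    refine (mul_le_one₀ h1 (by positivity) h2).trans ?_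
    simp; positivity
  · have hy0 : 0 < y := one_pos.trans hy
    have h2 : (1 + b * y ^ m)⁻¹ ^ j ≤ (b⁻¹) ^ j * (y ^ (j * m))⁻¹ := by
      rw [mul_comm j, pow_mul, ← inv_pow, ← mul_pow, ← mul_inv]
      gcongr
      linarith
    rw [abs_of_nonneg (by positivity)]
    have h3 := pow_div_le_rpow_neg_two (d := n - 1) (m := j * m) (by omega) hy
    calc y ^ (n - 1) * (1 + b * y ^ m)⁻¹ ^ j
        ≤ y ^ (n - 1) * ((b⁻¹) ^ j * (y ^ (j * m))⁻¹) := by gcongr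
      _ = (b⁻¹) ^ j * (y ^ (n - 1) / y ^ (j * m)) := by ring
      _ ≤ (1 + (b⁻¹) ^ j) * y ^ (-2 : ℝ) := by gcongr; linarith

/-- For `m ≤ n` the radial density is at least `(1 + b)⁻¹ y⁻¹` on `y > 1`, so the integral diverges,
logarithmically when `n = m`. -/
theorem integrable_inv_one_add_pow_iff (hn : 1 ≤ n) (hb : 0 < b) :
    (Integrable fun k : EuclideanSpace ℝ (Fin n) ↦ (1 + b * ‖k‖ ^ m)⁻¹) ↔ n < m := by
  refine ⟨fun h ↦ ?_, fun h ↦ by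
    simpa using integrable_inv_one_add_pow (j := 1) hn hb (by rwa [one_mul])⟩
  by_contra! hmn
  rw [integrable_norm_iff_integrableOn_Ioi hn fun y ↦ (1 + b * y ^ m)⁻¹] at h
  refine not_integrableOn_Ioi_of_inv_le_at_top (c := (1 + b)⁻¹) (by positivity) (fun y hy ↦ ?_) h
  have hy0 : 0 < y := one_pos.trans hy
  rw [← mul_inv, ← div_eq_mul_inv, le_div_iff₀ (by positivity), inv_mul_le_iff₀ (by positivity),
    mul_assoc, ← pow_succ', Nat.sub_add_cancel hn]
  have h1 : y ^ m ≤ y ^ n := pow_le_pow_right₀ hy.le hmn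
  have h2 : 1 ≤ y ^ n := one_le_pow₀ hy.le
  nlinarith

/-- Near `0` the radial density behaves like `y ^ (n - 1 - m)`, integrable exactly for `m < n`; the
tail converges because `n < 2m`. -/
theorem integrable_inv_mul_inv_one_add_pow_iff (hn : 1 ≤ n) (hb : 0 < b) (hnm : n < 2 * m) :
    (Integrable fun k : EuclideanSpace ℝ (Fin n) ↦
      (b * ‖k‖ ^ m)⁻¹ * (1 + b * ‖k‖ ^ m)⁻¹) ↔ m < n := by
  rw [integrable_norm_iff_integrableOn_Ioi hn fun y ↦ (b * y ^ m)⁻¹ * (1 + b * y ^ m)⁻¹]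
  constructor
  · intro h
    by_contra! hmn
    refine not_integrableOn_Ioi_of_inv_le_at_zero (c := b⁻¹ * (1 + b)⁻¹) (by positivity)
      (fun y hy hy1 ↦ ?_) h
    have h1 : y ^ m ≤ y ^ n := pow_le_pow_of_le_one hy.le hy1 hmn
    have h2 : y ^ m ≤ 1 := pow_le_one₀ hy.le hy1
    calc b⁻¹ * (1 + b)⁻¹ * y⁻¹ = b⁻¹ * (y ^ (n - 1) * (y ^ n)⁻¹) * (1 + b)⁻¹ := by
          obtain ⟨d, rfl⟩ := Nat.exists_eq_add_of_le' hn
          rw [Nat.add_sub_cancel, pow_succ]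
          field_simp
      _ ≤ b⁻¹ * (y ^ (n - 1) * (y ^ m)⁻¹) * (1 + b * y ^ m)⁻¹ := by
          gcongr
          nlinarith
      _ = _ := by rw [mul_inv]; ring
  · intro h
    refine integrableOn_Ioi_of_bounds (C := b⁻¹ + b⁻¹ * b⁻¹) (by fun_prop) (fun y hy hy1 ↦ ?_)
      fun y hy ↦ ?_
    · have h1 : y ^ (n - 1) * (y ^ m)⁻¹ ≤ 1 := by
        rw [← div_eq_mul_inv, div_le_one₀ (by positivity)]
        exact pow_le_pow_of_le_one hy.le hy1 (by omega)
      have h2 : (1 + b * y ^ m)⁻¹ ≤ 1 := inv_le_one_of_one_le₀ (by simp; positivity)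
      rw [abs_of_nonneg (by positivity)]
      calc y ^ (n - 1) * ((b * y ^ m)⁻¹ * (1 + b * y ^ m)⁻¹)
          = b⁻¹ * (y ^ (n - 1) * (y ^ m)⁻¹) * (1 + b * y ^ m)⁻¹ := by rw [mul_inv]; ring
        _ ≤ b⁻¹ * 1 * 1 := by gcongr
        _ ≤ b⁻¹ + b⁻¹ * b⁻¹ := by simp; positivity
    · have hy0 : 0 < y := one_pos.trans hy
      have h3 := pow_div_le_rpow_neg_two (d := n - 1) (m := 2 * m) (by omega) hy
      rw [abs_of_nonneg (by positivity)]
      calc y ^ (n - 1) * ((b * y ^ m)⁻¹ * (1 + b * y ^ m)⁻¹)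
          ≤ y ^ (n - 1) * ((b * y ^ m)⁻¹ * (b * y ^ m)⁻¹) := by gcongr; linarith
        _ = b⁻¹ * b⁻¹ * (y ^ (n - 1) / y ^ (2 * m)) := by rw [mul_inv, two_mul, pow_add]; ring
        _ ≤ (b⁻¹ + b⁻¹ * b⁻¹) * y ^ (-2 : ℝ) := by
          gcongr
          simp; positivity

end Radial

/-! ### Operators unitarily equivalent to a multiplication operator -/

section Diagonalization

theorem abs_inv_one_add_le_one {α : Type*} {p : α → ℝ} (hp0 : ∀ k, 0 ≤ p k) (k : α) :
    |(1 + p k)⁻¹| ≤ 1 := by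
  have := hp0 k
  rw [abs_of_nonneg (by positivity)]
  exact inv_le_one_of_one_le₀ (by linarith)

variable {α : Type*} [MeasurableSpace α] {μ : Measure α}
variable {H : Type*} [NormedAddCommGroup H] [InnerProductSpace ℂ H]

/-- `U` transforms `A` into the maximal operator of multiplication by `p`. -/
def IsDiagonalizedBy (A : H →ₗ.[ℂ] H) (U : H ≃ₗᵢ[ℂ] Lp ℂ 2 μ) (p : α → ℝ) : Prop :=
  ∀ x y, (x, y) ∈ A.graph ↔ U y =ᵐ[μ] fun k ↦ (p k : ℂ) * U x k

/-- The operator on `H` that `U` transforms into multiplication by `(1 + p)⁻¹`. -/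
def resolventOf (U : H ≃ₗᵢ[ℂ] Lp ℂ 2 μ) (p : α → ℝ) (hp : Measurable p) (hp0 : ∀ k, 0 ≤ p k) :
    H →L[ℂ] H :=
  (U.symm.toContinuousLinearEquiv : Lp ℂ 2 μ →L[ℂ] H) ∘L
    mulBounded μ (fun k ↦ (1 + p k)⁻¹) (hp.const_add 1).inv (abs_inv_one_add_le_one hp0) ∘L
    (U.toContinuousLinearEquiv : H →L[ℂ] Lp ℂ 2 μ)

variable {U : H ≃ₗᵢ[ℂ] Lp ℂ 2 μ} {p : α → ℝ} {hp : Measurable p} {hp0 : ∀ k, 0 ≤ p k}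

theorem apply_resolventOf (x : H) : U (resolventOf U p hp hp0 x) =
    mulBounded μ (fun k ↦ (1 + p k)⁻¹) (hp.const_add 1).inv (abs_inv_one_add_le_one hp0) (U x) :=
  U.apply_symm_apply _

theorem coeFn_resolventOf (x : H) :
    U (resolventOf U p hp hp0 x) =ᵐ[μ] fun k ↦ (((1 + p k)⁻¹ : ℝ) : ℂ) * U x k := by
  rw [apply_resolventOf]
  exact coeFn_mulBounded _

theorem inner_resolventOf (x y : H) : inner ℂ (resolventOf U p hp hp0 x) y =
    inner ℂ (mulBounded μ (fun k ↦ (1 + p k)⁻¹) (hp.const_add 1).inv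
      (abs_inv_one_add_le_one hp0) (U x)) (U y) := by
  rw [← apply_resolventOf, U.inner_map_map]

theorem isUnitInterval_resolventOf : IsUnitInterval (resolventOf U p hp hp0) := by
  have h := isUnitInterval_mulBounded (μ := μ) (r := fun k ↦ (1 + p k)⁻¹) (hr := (hp.const_add 1).inv)
    (hr1 := abs_inv_one_add_le_one hp0) fun k ↦ inv_nonneg.2 (by have := hp0 k; positivity)
  refine ⟨fun x y ↦ ?_, fun x ↦ ?_, fun x ↦ ?_⟩
  · rw [inner_resolventOf, h.symm, ← apply_resolventOf, U.inner_map_map]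
  · rw [inner_resolventOf]
    exact h.nonneg _
  · rw [inner_resolventOf, ← U.norm_map]
    exact h.le_one _

theorem IsDiagonalizedBy.isInverseOneAdd {A : H →ₗ.[ℂ] H} (hA : IsDiagonalizedBy A U p) :
    IsInverseOneAdd A (resolventOf U p hp hp0) := by
  have hpos (k : α) : (1 : ℂ) + p k ≠ 0 := by
    have := hp0 k
    exact_mod_cast (by positivity : (1 : ℝ) + p k ≠ 0)
  constructor
  · intro x
    apply U.injective
    ext1
    filter_upwards [coeFn_resolventOf (hp := hp) (hp0 := hp0) (U := U) ((x : H) + A x),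
      (hA x (A x)).1 (A.mem_graph x), Lp.coeFn_add (U x) (U (A x))] with k h1 h2 h3
    rw [map_add U] at h1
    rw [h1, h3, Pi.add_apply, h2, Complex.ofReal_inv, Complex.ofReal_add,
      Complex.ofReal_one, ← one_add_mul, inv_mul_cancel_left₀ (hpos k)]
  · intro y
    have hy : (resolventOf U p hp hp0 y, y - resolventOf U p hp hp0 y) ∈ A.graph := by
      rw [hA]
      filter_upwards [coeFn_resolventOf (hp := hp) (hp0 := hp0) (U := U) y,
        Lp.coeFn_sub (U y) (U (resolventOf U p hp hp0 y))] with k h1 h2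
      rw [map_sub, h2, Pi.sub_apply, h1, Complex.ofReal_inv, Complex.ofReal_add, Complex.ofReal_one]
      have := hpos k
      field_simp
      ring
    obtain ⟨x, hx, hxy⟩ := (LinearPMap.mem_graph_iff A).1 hy
    exact ⟨x, hx, by rw [hx, hxy, add_sub_cancel]⟩

theorem inner_symm_toLp (hg : MemLp (fun k ↦ (((1 + p k)⁻¹ : ℝ) : ℂ)) 2 μ) (x : H) :
    inner ℂ (U.symm (hg.toLp _)) x = inner ℂ (hg.toLp _) (U x) := by
  rw [← U.inner_map_map, U.apply_symm_apply]

/-- This identifies the defect vector: the constraint of vanishing integral on `R x` is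
orthogonality of `x` to `g`. -/
theorem inner_symm_toLp_eq_integral (hg : MemLp (fun k ↦ (((1 + p k)⁻¹ : ℝ) : ℂ)) 2 μ) (x : H) :
    inner ℂ (U.symm (hg.toLp _)) x = ∫ k, U (resolventOf U p hp hp0 x) k ∂μ := by
  rw [inner_symm_toLp, inner_toLp_ofReal]
  exact (integral_congr_ae (coeFn_resolventOf x)).symm

theorem integrable_resolventOf (hg : MemLp (fun k ↦ (((1 + p k)⁻¹ : ℝ) : ℂ)) 2 μ) (x : H) :
    Integrable (U (resolventOf U p hp hp0 x)) μ :=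
  (hg.integrable_mul (Lp.memLp (U x))).congr (coeFn_resolventOf x).symm

theorem IsDiagonalizedBy.isPointRestriction [NeZero μ] {A : H →ₗ.[ℂ] H} {D : Submodule ℂ H}
    (hA : IsDiagonalizedBy A U p)
    (hg : MemLp (fun k ↦ (((1 + p k)⁻¹ : ℝ) : ℂ)) 2 μ)
    (hD : ∀ x, Integrable (U x) μ → (x ∈ D ↔ ∫ k, U x k ∂μ = 0)) :
    IsPointRestriction A (resolventOf U p hp hp0) (U.symm (hg.toLp _)) D where
  inverse := hA.isInverseOneAdd
  unit := isUnitInterval_resolventOf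
  ne_zero := by
    rw [Ne, U.symm.map_eq_zero_iff]
    intro h
    have h1 := hg.coeFn_toLp
    rw [h] at h1
    have hfalse : ∀ᵐ k ∂μ, False := by
      filter_upwards [h1, Lp.coeFn_zero ℂ 2 μ] with k h2 h3
      have hk : (((1 + p k)⁻¹ : ℝ) : ℂ) = 0 := h2.symm.trans h3
      have := hp0 k
      exact (by positivity : (1 + p k)⁻¹ ≠ 0) (Complex.ofReal_eq_zero.1 hk)
    simp [NeZero.ne μ] at hfalse
  mem_iff x := by rw [hD _ (integrable_resolventOf hg x), inner_symm_toLp_eq_integral]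

theorem dominatesRankOne_symm_iff {q : Lp ℂ 2 μ → ℝ} {g : Lp ℂ 2 μ} :
    DominatesRankOne (fun x ↦ q (U x)) (U.symm g) ↔ DominatesRankOne q g := by
  refine exists_congr fun c ↦ and_congr_right fun _ ↦ ?_
  rw [U.surjective.forall]
  refine forall_congr' fun x ↦ ?_
  rw [← U.inner_map_map, U.apply_symm_apply]

/-- Here the weight `w` equals `r = (1 + p)⁻¹`, so `r²/w = r`. -/
theorem dominates_resolventOf_iff [SigmaFinite μ]
    (hg : MemLp (fun k ↦ (((1 + p k)⁻¹ : ℝ) : ℂ)) 2 μ) :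
    DominatesRankOne (fun x ↦ (inner ℂ (resolventOf U p hp hp0 x) x).re) (U.symm (hg.toLp _)) ↔
      Integrable (fun k ↦ (1 + p k)⁻¹) μ := by
  simp only [inner_resolventOf, re_inner_mulBounded]
  have hpos (k : α) : 0 < 1 + p k := by have := hp0 k; positivity
  have hr : Measurable fun k ↦ (1 + p k)⁻¹ := (hp.const_add 1).inv
  rw [dominatesRankOne_symm_iff (q := fun f ↦ ∫ k, (1 + p k)⁻¹ * ‖f k‖ ^ 2 ∂μ),
    dominatesRankOne_iff_integrable hr (abs_inv_one_add_le_one hp0) hr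
      (Filter.Eventually.of_forall fun k ↦ inv_pos.2 (hpos k)) (abs_inv_one_add_le_one hp0)]
  refine integrable_congr (Filter.Eventually.of_forall fun k ↦ ?_)
  beta_reduce
  rw [sq]
  exact mul_div_cancel_right₀ _ (inv_pos.2 (hpos k)).ne'

/-- Here `w = 1 - r = p r`, so `r²/w = p⁻¹ r`; positivity of `p` almost everywhere makes the weight
positive. -/
theorem dominates_one_sub_resolventOf_iff [SigmaFinite μ] (hppos : ∀ᵐ k ∂μ, 0 < p k)
    (hg : MemLp (fun k ↦ (((1 + p k)⁻¹ : ℝ) : ℂ)) 2 μ) :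
    DominatesRankOne (fun x ↦ ‖x‖ ^ 2 - (inner ℂ (resolventOf U p hp hp0 x) x).re)
      (U.symm (hg.toLp _)) ↔ Integrable (fun k ↦ (p k)⁻¹ * (1 + p k)⁻¹) μ := by
  have hpos (k : α) : 0 < 1 + p k := by have := hp0 k; positivity
  have hr : Measurable fun k ↦ (1 + p k)⁻¹ := (hp.const_add 1).inv
  have hr1 := abs_inv_one_add_le_one hp0
  have hrle (k : α) : (1 + p k)⁻¹ ≤ 1 := (le_abs_self _).trans (hr1 k)
  have hq (x : H) : ‖x‖ ^ 2 - (inner ℂ (resolventOf U p hp hp0 x) x).re =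
      ∫ k, (1 - (1 + p k)⁻¹) * ‖U x k‖ ^ 2 ∂μ := by
    rw [inner_resolventOf, ← U.norm_map, norm_sq_sub_re_inner_mulBounded]
  simp only [hq]
  rw [dominatesRankOne_symm_iff (q := fun f ↦ ∫ k, (1 - (1 + p k)⁻¹) * ‖f k‖ ^ 2 ∂μ),
    dominatesRankOne_iff_integrable hr hr1 (hr.const_sub 1)]
  · refine integrable_congr ?_
    filter_upwards [hppos] with k hk
    have h1 := (hpos k).ne'
    have h2 : 1 - (1 + p k)⁻¹ = p k * (1 + p k)⁻¹ := by field_simp; ring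
    rw [h2]
    field_simp
  · filter_upwards [hppos] with k hk
    rw [sub_pos]
    exact inv_lt_one_of_one_lt₀ (by linarith)
  · intro k
    have := inv_pos.2 (hpos k)
    rw [abs_of_nonneg (sub_nonneg.2 (hrle k))]
    linarith

/-- The trichotomy for operators unitarily equivalent to multiplication by `b |k|ᵐ`. -/
theorem IsDiagonalizedBy.trichotomy [CompleteSpace H] {n m : ℕ} (hn : 1 ≤ n) (hnm : n < 2 * m)
    {b : ℝ} (hb : 0 < b) {U : H ≃ₗᵢ[ℂ] L2 n} {A : H →ₗ.[ℂ] H} {D : Submodule ℂ H}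
    (hA : IsDiagonalizedBy A U fun k ↦ b * ‖k‖ ^ m)
    (hD : ∀ x, Integrable (U x) → (x ∈ D ↔ ∫ k, U x k = 0)) :
    A ∈ nonnegExtensions (A.domRestrict D) ∧
      (n < m → (nonnegSingularPerturbations A (A.domRestrict D)).Infinite ∧
        IsMinimalElement (nonnegExtensions (A.domRestrict D)) A) ∧
      (n = m → nonnegSingularPerturbations A (A.domRestrict D) = ∅) ∧
      (m < n → (nonnegSingularPerturbations A (A.domRestrict D)).Infinite ∧
        IsMaximalElement (nonnegExtensions (A.domRestrict D)) A) := by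
  have : Nontrivial (EuclideanSpace ℝ (Fin n)) := by
    have : Nonempty (Fin n) := ⟨⟨0, hn⟩⟩
    infer_instance
  have hp : Measurable fun k : EuclideanSpace ℝ (Fin n) ↦ b * ‖k‖ ^ m := by fun_prop
  have hp0 (k : EuclideanSpace ℝ (Fin n)) : 0 ≤ b * ‖k‖ ^ m := by positivity
  have hppos : ∀ᵐ k : EuclideanSpace ℝ (Fin n), 0 < b * ‖k‖ ^ m := by
    filter_upwards [Measure.ae_ne volume (0 : EuclideanSpace ℝ (Fin n))] with k hk
    positivity
  have hg : MemLp (fun k : EuclideanSpace ℝ (Fin n) ↦ (((1 + b * ‖k‖ ^ m)⁻¹ : ℝ) : ℂ)) 2 volume :=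
    MemLp.ofReal ((memLp_two_iff_integrable_sq (hp.const_add 1).inv.aestronglyMeasurable).2
      (integrable_inv_one_add_pow hn hb hnm))
  refine (hA.isPointRestriction (hp := hp) (hp0 := hp0) hg hD).trichotomy ?_ ?_
  · rw [dominates_resolventOf_iff, integrable_inv_one_add_pow_iff hn hb]
  · rw [dominates_one_sub_resolventOf_iff hppos,
      integrable_inv_mul_inv_one_add_pow_iff hn hb hnm]

end Diagonalization

/-! ### The momentum representation -/

section Momentum

theorem mulPow_isDiagonalizedBy (n l : ℕ) :
    IsDiagonalizedBy (mulPow n l) (LinearIsometryEquiv.refl ℂ (L2 n))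
      fun k ↦ 1 * ‖k‖ ^ (2 * l) := by
  intro f g
  simp only [one_mul, LinearIsometryEquiv.coe_refl, id_eq]
  rw [LinearPMap.mem_graph_iff]
  constructor
  · rintro ⟨x, rfl, rfl⟩
    exact (memLp_of_mem_mulPowDomain x.2).coeFn_toLp
  · intro h
    have hf : f ∈ mulPowDomain n l := (Lp.memLp g).ae_eq h
    refine ⟨⟨f, hf⟩, rfl, ?_⟩
    ext1
    exact (memLp_of_mem_mulPowDomain hf).coeFn_toLp.trans h.symm

theorem mem_integralZero_iff {n : ℕ} {f : L2 n} (hf : Integrable f) :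
    f ∈ integralZero n ↔ ∫ k, f k = 0 :=
  and_iff_right hf

end Momentum

/-! ### The position representation, via the Fourier transform -/

section Position

open FourierTransform

variable {n : ℕ}

theorem toDistr_apply (f : L2 n) (φ : 𝓢(EuclideanSpace ℝ (Fin n), ℂ)) :
    toDistr n f φ = ∫ x, φ x • f x :=
  Lp.toTemperedDistribution_apply f φ

theorem fourier_toDistr (f : L2 n) : 𝓕 (toDistr n f) = toDistr n (𝓕 f) :=
  Lp.fourier_toTemperedDistribution_eq f

/-- Locally integrable functions that agree as distributions agree almost everywhere. -/
theorem ae_eq_of_integral_schwartz_smul_eq {f g : EuclideanSpace ℝ (Fin n) → ℂ}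
    (hf : LocallyIntegrable f) (hg : LocallyIntegrable g)
    (h : ∀ φ : 𝓢(EuclideanSpace ℝ (Fin n), ℂ), ∫ x, φ x • f x = ∫ x, φ x • g x) :
    f =ᵐ[volume] g := by
  refine ae_eq_of_integral_contDiff_smul_eq hf hg fun φ hφ hφc ↦ ?_
  have hc : HasCompactSupport fun x ↦ (φ x : ℂ) := hφc.comp_left Complex.ofReal_zero
  exact h (hc.toSchwartzMap (Complex.ofRealCLM.contDiff.comp hφ))

theorem locallyIntegrable_coeFn (f : L2 n) : LocallyIntegrable f :=
  (Lp.memLp f).locallyIntegrable one_le_two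

theorem toDistr_eq_smulLeftCLM_iff {p : EuclideanSpace ℝ (Fin n) → ℂ} (hp : p.HasTemperateGrowth)
    (f g : L2 n) : toDistr n g = TemperedDistribution.smulLeftCLM ℂ p (toDistr n f) ↔
      g =ᵐ[volume] fun k ↦ p k * f k := by
  have key (φ : 𝓢(EuclideanSpace ℝ (Fin n), ℂ)) :
      TemperedDistribution.smulLeftCLM ℂ p (toDistr n f) φ = ∫ k, φ k • (p k * f k) := by
    rw [TemperedDistribution.smulLeftCLM_apply_apply, toDistr_apply]
    refine integral_congr_ae (Filter.Eventually.of_forall fun k ↦ ?_)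
    simp only [SchwartzMap.smulLeftCLM_apply_apply hp, smul_eq_mul]
    ring
  constructor
  · intro h
    refine ae_eq_of_integral_schwartz_smul_eq (locallyIntegrable_coeFn g) ?_ fun φ ↦ ?_
    · rw [locallyIntegrable_iff]
      exact fun K hK ↦ ((locallyIntegrable_coeFn f).integrableOn_isCompact hK).continuousOn_mul
        hp.1.continuous.continuousOn hK
    · rw [← key, ← h, toDistr_apply]
  · intro h
    ext φ
    rw [key, toDistr_apply]
    refine integral_congr_ae ?_
    filter_upwards [h] with k hk
    rw [hk]

theorem hasTemperateGrowth_norm_pow (b : ℝ) (l : ℕ) :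
    (fun k : EuclideanSpace ℝ (Fin n) ↦ ((b * ‖k‖ ^ (2 * l) : ℝ) : ℂ)).HasTemperateGrowth := by
  simp only [pow_mul]
  fun_prop

/-- The factor `(2π)^(2l)` reflects the normalization of the Fourier transform with kernel
`exp(-2πi⟨x, k⟩)`; it is the constant `b` of the trichotomy. -/
theorem fourier_distrLaplacian_pow (l : ℕ) (u : 𝓢'(EuclideanSpace ℝ (Fin n), ℂ)) :
    𝓕 (((-distrLaplacian n) ^ l) u) = TemperedDistribution.smulLeftCLM ℂ
      (fun k ↦ (((2 * Real.pi) ^ (2 * l) * ‖k‖ ^ (2 * l) : ℝ) : ℂ)) (𝓕 u) := by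
  induction l with
  | zero => simp
  | succ l ih =>
    have h (v : 𝓢'(EuclideanSpace ℝ (Fin n), ℂ)) : 𝓕 ((-distrLaplacian n) v) =
        TemperedDistribution.smulLeftCLM ℂ
          (fun k ↦ (((2 * Real.pi) ^ 2 * ‖k‖ ^ (2 * 1) : ℝ) : ℂ)) (𝓕 v) := by
      change 𝓕 (-Δ v) = _
      rw [TemperedDistribution.laplacian_eq_fourierMultiplierCLM,
        TemperedDistribution.fourierMultiplierCLM_apply, neg_smul, neg_neg,
        ← Complex.coe_smul, FourierTransform.fourier_smul, fourier_fourierInv_eq]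
      have hg : (fun x : EuclideanSpace ℝ (Fin n) ↦ ((‖x‖ ^ 2 : ℝ) : ℂ)).HasTemperateGrowth := by
        fun_prop
      have hs := congrArg (fun T ↦ T (𝓕 v))
        (TemperedDistribution.smulLeftCLM_smul (F := ℂ) hg (((2 * Real.pi) ^ 2 : ℝ) : ℂ))
      refine hs.symm.trans ?_
      congr 2
      ext x
      simp
    rw [pow_succ', Module.End.mul_apply, h, ih,
      TemperedDistribution.smulLeftCLM_smulLeftCLM_apply (hasTemperateGrowth_norm_pow _ _)
        (hasTemperateGrowth_norm_pow _ _)]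
    congr 2
    ext k
    simp only [Pi.mul_apply, ← Complex.ofReal_mul]
    ring_nf

theorem mem_graph_polyharmonic_iff (l : ℕ) (f g : L2 n) :
    (f, g) ∈ (polyharmonic n l).graph ↔
      toDistr n g = ((-distrLaplacian n) ^ l) (toDistr n f) := by
  rw [LinearPMap.mem_graph_iff]
  constructor
  · rintro ⟨x, rfl, rfl⟩
    exact toDistr_polyharmonic n l x
  · intro h
    refine ⟨⟨f, ⟨g, h⟩⟩, rfl, toDistr_injective n ?_⟩
    rw [toDistr_polyharmonic, h]

theorem polyharmonic_isDiagonalizedBy (n l : ℕ) :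
    IsDiagonalizedBy (polyharmonic n l)
      (Lp.fourierTransformₗᵢ (EuclideanSpace ℝ (Fin n)) ℂ)
      fun k ↦ (2 * Real.pi) ^ (2 * l) * ‖k‖ ^ (2 * l) := by
  intro f g
  have hinj : Function.Injective (𝓕 : 𝓢'(EuclideanSpace ℝ (Fin n), ℂ) → _) :=
    Function.LeftInverse.injective (g := 𝓕⁻) fun u ↦ fourierInv_fourier_eq u
  rw [mem_graph_polyharmonic_iff, ← hinj.eq_iff, fourier_distrLaplacian_pow, fourier_toDistr,
    fourier_toDistr]
  exact toDistr_eq_smulLeftCLM_iff (hasTemperateGrowth_norm_pow _ _) _ _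

theorem continuous_fourierInv_of_integrable {h : EuclideanSpace ℝ (Fin n) → ℂ}
    (hh : Integrable h) : Continuous (𝓕⁻ h) :=
  VectorFourier.fourierIntegral_continuous Real.continuous_fourierChar
    (L := -innerₗ (EuclideanSpace ℝ (Fin n))) continuous_inner.neg hh

/-- If the Fourier transform of `f ∈ L²` is integrable, then `f` is given by the inverse Fourier
integral. -/
theorem ae_eq_fourierInv {f : L2 n} (hf : Integrable (𝓕 f : L2 n)) :
    f =ᵐ[volume] 𝓕⁻ ((𝓕 f : L2 n) : EuclideanSpace ℝ (Fin n) → ℂ) := by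
  refine ae_eq_of_integral_schwartz_smul_eq (locallyIntegrable_coeFn f)
    (continuous_fourierInv_of_integrable hf).locallyIntegrable fun φ ↦ ?_
  have h1 : toDistr n f = 𝓕⁻ (toDistr n (𝓕 f)) := by
    rw [← fourier_toDistr, fourierInv_fourier_eq]
  rw [← toDistr_apply, h1, TemperedDistribution.fourierInv_apply, toDistr_apply,
    SchwartzMap.fourierInv_coe]
  -- Fubini moves the inverse Fourier integral from `φ` to the integrable function; the pairing
  -- `-⟨x, y⟩` is symmetric, so the flip is harmless.
  have h2 := VectorFourier.integral_fourierIntegral_smul_eq_flip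
    (L := -innerₗ (EuclideanSpace ℝ (Fin n))) Real.continuous_fourierChar
    continuous_inner.neg (φ.integrable (μ := volume)) hf
  have h3 : (-innerₗ (EuclideanSpace ℝ (Fin n))).flip = -innerₗ (EuclideanSpace ℝ (Fin n)) := by
    ext x y
    simp [real_inner_comm]
  rw [h3] at h2
  exact h2

/-- Fourier inversion at `0` gives the integral, and continuous functions equal almost everywhere
are equal, so the choice of representative is immaterial. -/
theorem mem_vanishAtOrigin_iff {f : L2 n} (hf : Integrable (𝓕 f : L2 n)) :
    f ∈ vanishAtOrigin n ↔ ∫ k, (𝓕 f : L2 n) k = 0 := by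
  have h0 : 𝓕⁻ ((𝓕 f : L2 n) : EuclideanSpace ℝ (Fin n) → ℂ) 0 = ∫ k, (𝓕 f : L2 n) k := by
    simp [Real.fourierInv_eq]
  have hc := continuous_fourierInv_of_integrable hf
  rw [← h0]
  constructor
  · rintro ⟨g, hg, hfg, hg0⟩
    rw [← (hg.ae_eq_iff_eq volume hc).1 (hfg.symm.trans (ae_eq_fourierInv hf)), hg0]
  · intro h
    exact ⟨_, hc, ae_eq_fourierInv hf, h⟩

end Position

end PointPerturbation

end

open PointPerturbation
theorem mainTheorem5 (n l : ℕ) (hn : 1 ≤ n) (hnl : n + 1 ≤ 4 * l) :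
    -- multiplication by `|k|^{2l}`, restricted to `∫ f = 0`
    (mulPow n l ∈ nonnegExtensions (mulPowPoint n l) ∧
      (n < 2 * l →
        (nonnegSingularPerturbations (mulPow n l) (mulPowPoint n l)).Infinite ∧
        IsMinimalElement (nonnegExtensions (mulPowPoint n l)) (mulPow n l)) ∧
      (n = 2 * l →
        nonnegSingularPerturbations (mulPow n l) (mulPowPoint n l) = ∅) ∧
      (2 * l < n →
        (nonnegSingularPerturbations (mulPow n l) (mulPowPoint n l)).Infinite ∧
        IsMaximalElement (nonnegExtensions (mulPowPoint n l)) (mulPow n l))) ∧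
    -- the polyharmonic operator `(-Δ)^l`, restricted to `f(0) = 0`
    (polyharmonic n l ∈ nonnegExtensions (polyharmonicPoint n l) ∧
      (n < 2 * l →
        (nonnegSingularPerturbations (polyharmonic n l) (polyharmonicPoint n l)).Infinite ∧
        IsMinimalElement (nonnegExtensions (polyharmonicPoint n l)) (polyharmonic n l)) ∧
      (n = 2 * l →
        nonnegSingularPerturbations (polyharmonic n l) (polyharmonicPoint n l) = ∅) ∧
      (2 * l < n →
        (nonnegSingularPerturbations (polyharmonic n l) (polyharmonicPoint n l)).Infinite ∧
        IsMaximalElement (nonnegExtensions (polyharmonicPoint n l)) (polyharmonic n l))) := by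
  have h2 : n < 2 * (2 * l) := by omega
  have hx (f : L2 n) (hf : Integrable (LinearIsometryEquiv.refl ℂ (L2 n) f)) :=
    mem_integralZero_iff hf
  exact ⟨(mulPow_isDiagonalizedBy n l).trichotomy hn h2 one_pos hx,
    (polyharmonic_isDiagonalizedBy n l).trichotomy hn h2 (by positivity) fun f hf ↦
      mem_vanishAtOrigin_iff hf⟩
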